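/- **Notation.** Let $K$ be a field and let $q,t\in K^\times$ be multiplicatively independent, i.e. $q^mt^n=1$ with $m,n\in\mathbb Z$ only for $m=n=0$ (for instance $K=\mathbb C(q,t)$ with $q,t$ the two variables). Put $(x;p)_n=\prod_{k=0}^{n-1}(1-p^kx)$. For $\boldsymbol n\in\mathbb Z^3$ put $\underline{\boldsymbol n}=n_1+n_2+n_3$, $|\boldsymbol n|^2=n_1^2+n_2^2+n_3^2$ and $n'_k=n_{ij}=\frac12(n_i+n_j-n_k)$ for $\{i,j,k\}=\{1,2,3\}$, so that $n_a=n_{ab}+n_{ac}=n'_b+n'_c$ for $\{a,b,c\}=\{1,2,3\}$. Let $\boldsymbol\delta^1,\boldsymbol\delta^2,\boldsymbol\delta^3$ be the standard basis of $\mathbb Z^3$. A triple $\boldsymbol l\in\mathbb Z_{\ge0}^3$ is *admissible* if $\underline{\boldsymbol l}$ is even and $l_1\le l_2+l_3$, $l_2\le l_1+l_3$, $l_3\le l_1+l_2$. All polynomials lie in $K[x_{12}^{\pm1},x_{13}^{\pm1},x_{23}^{\pm1}]$, and $x_{ji}=x_{ij}$. **The polynomials $\phi_{\boldsymbol l}$.**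 Let $\boldsymbol l$ be admissible. For $\boldsymbol k\in\mathbb Z_{\ge0}^3$ let $\Delta(\boldsymbol k|\boldsymbol l)$ be the finite set of all $(\boldsymbol r',s,\boldsymbol n)=(r_{23},r_{13},r_{12},s,n_1,n_2,n_3)\in\mathbb Z_{\ge0}^7$ with $$2k_{ab}-l_{ab}\le r_{ab}\qquad\text{and}\qquad r_a\le n_a\le k_a-s,\quad\text{where } r_a:=r_{ab}+r_{ac}\text{ and }\{a,b,c\}=\{1,2,3\}.$$ Set $$\phi_{\boldsymbol l}=\sum_{\boldsymbol k\in\mathbb Z_{\ge0}^3,\ \underline{\boldsymbol k}\le\underline{\boldsymbol l}}\ \sum_{(\boldsymbol r',s,\boldsymbol n)\in\Delta(\boldsymbol k|\boldsymbol l)}C_{\boldsymbol l,\boldsymbol k}(\boldsymbol r',s,\boldsymbol n)\prod_{1\le a<b\le3}x_{ab}^{\,l_{ab}-2k_{ab}},$$ where $$\begin{aligned}C_{\boldsymbol l,\boldsymbol k}(\boldsymbol r',s,\boldsymbol n)&=\frac{(-1)^s(q^2t^{-1})^{\underline{\boldsymbol l}+\underline{\boldsymbol r}-\underline{\boldsymbol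 k}+2s}\,q^{\underline{\boldsymbol n}^2-\underline{\boldsymbol r}^2+3|\boldsymbol r|^2-|\boldsymbol n|^2-2\boldsymbol r\cdot\boldsymbol n+(s+1)(s+2(\underline{\boldsymbol n}-\underline{\boldsymbol r}))}}{(q^2;q^2)_s\,(q^2t^2;q^2)_{\underline{\boldsymbol n}+\frac12\underline{\boldsymbol l}-\underline{\boldsymbol k}+3s}}\\&\quad\times\prod_{a=1}^3q^{2(n_a-r_a)(l'_a-2k'_a)}\frac{(t^2;q^2)_{n_a+l_a-k_a+s}\,(q^{-2l_a};q^2)_{n_a+l_a-k_a+s}}{(q^2;q^2)_{n_a-r_a}(q^2;q^2)_{r'_a}(q^2;q^2)_{l'_a+r'_a-2k'_a}}.\end{aligned}$$ For $\boldsymbol l\in\mathbb Z^3$ not admissible set $\phi_{\boldsymbol l}=0$. **The genus 2 Macdonald polynomials of Arthamonov and Shakirov.** With $[n,m]_{q,t}=\dfrac{q^nt^m-q^{-n}t^{-m}}{q-q^{-1}}$, put for $\{i,j,k\}=\{1,2,3\}$ and $a,b\in\{\pm1\}$ $$C^{ij}_{a,b}(\boldsymbol l)=ab\,\frac{\left[\frac{al_i+bl_j+l_k}2,\frac{a+b+2}2\right]_{q,t}\left[\frac{al_i+bl_j-l_k}2,\frac{a+b}2\right]_{q,t}[l_i-1,2]_{q,t}[l_j-1,2]_{q,t}}{[l_i,\frac{a+3}2]_{q,t}[l_i-1,\frac{a+3}2]_{q,t}[l_j,\frac{b+3}2]_{q,t}[l_j-1,\frac{b+3}2]_{q,t}}.$$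 The genus 2 Macdonald polynomials are the family $(\Phi_{\boldsymbol l})_{\boldsymbol l\in\mathbb Z^3}$ with $\Phi_{(0,0,0)}=1$, with $\Phi_{\boldsymbol l}=0$ for $\boldsymbol l$ not admissible, and with $$(x_{ij}+x_{ij}^{-1})\Phi_{\boldsymbol l}=\sum_{a,b\in\{\pm1\}}C^{ij}_{a,b}(\boldsymbol l)\,\Phi_{\boldsymbol l+a\boldsymbol\delta^i+b\boldsymbol\delta^j}\qquad(\boldsymbol l\text{ admissible},\ i\ne j).$$ **Theorem.** (1) (Pieri rule) For every admissible $\boldsymbol l$ and all $i\neq j$ in $\{1,2,3\}$, $$(x_{ij}+x_{ij}^{-1})\phi_{\boldsymbol l}=\frac{(1-q^{2l_i})(1-q^{2l_j})}{(1-t^2q^{2l_i})(1-t^2q^{2l_j})}\sum_{a,b\in\{\pm1\}}\widetilde A_{a,b}\,\phi_{\boldsymbol l+a\boldsymbol\delta^i+b\boldsymbol\delta^j},$$ where $$\begin{aligned} \widetilde A_{+,+}&=t^2q^{2(l_i+l_j)}\frac{(1-t^2q^{\underline{\boldsymbol l}+2})(1-q^{2(l_{ij}+1)})}{(1-q^{2l_i})(1-q^{2l_j})(1-q^{2(l_i+1)})(1-q^{2(l_j+1)})},\\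 \widetilde A_{+,-}&=t\,q^{2(l_i-l'_i+1)}\frac{(1-t^2q^{2(l'_i-1)})(1-q^{2(l'_j+1)})}{(1-q^{2l_i})(1-q^{2(l_i+1)})},\\ \widetilde A_{-,+}&=t\,q^{2(l_j-l'_j+1)}\frac{(1-t^2q^{2(l'_j-1)})(1-q^{2(l'_i+1)})}{(1-q^{2l_j})(1-q^{2(l_j+1)})},\\ \widetilde A_{-,-}&=t^{-2}q^{2(2-l_i-l_j)}(1-t^4q^{\underline{\boldsymbol l}-2})(1-t^2q^{2(l_{ij}-1)}). \end{aligned}$$ If $l_i=0$ or $l_j=0$, the products of the prefactor with the $\widetilde A_{a,b}$ are understood after cancelling the common factors $1-q^{2l_i}$ and $1-q^{2l_j}$. (2) (Relation of the normalizations) The genus 2 Macdonald polynomials exist, are unique, and are given for all $\boldsymbol l\in\mathbb Z^3$ by $$\Phi_{\boldsymbol l}=(tq^{-2})^{\frac12\underline{\boldsymbol l}}\,\frac{N_{X_7}(\boldsymbol l)}{N_{AS}(\boldsymbol l)}\,\phi_{\boldsymbol l}$$ (both sides being $0$ if $\boldsymbol l$ is not admissible), where $$N_{X_7}(\boldsymbol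 l)=q^{|\boldsymbol l|^2}(t^2q^2;q^2)_{\frac12\underline{\boldsymbol l}}\prod_{a=1}^3\frac{(q^2;q^2)_{l'_a}}{(q^2;q^2)_{l_a}(t^2;q^2)_{l_a}},\qquad N_{AS}(\boldsymbol l)=(t^4;q^2)_{\frac12\underline{\boldsymbol l}}\prod_{a=1}^3\frac{(t^2;q^2)_{l'_a}}{(t^4;q^2)_{l_a}}.$$ -/

import Mathlib

namespace GenusTwo

open Finset

/-- A triple `(n_1, n_2, n_3)` of integers, indexed by `Fin 3`. -/
abbrev Triple := Fin 3 → ℤ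

/-- `|n| = n_1 + n_2 + n_3`, the sum of the entries of a triple. -/
def total (n : Triple) : ℤ := ∑ a, n a

/-- The integer `2 n'_k = 2 n_{ij} = n_i + n_j - n_k`, where `{i, j, k} = {1, 2, 3}`. -/
def twicePrime (n : Triple) (k : Fin 3) : ℤ := total n - 2 * n k

/-- `n'_k = n_{ij} = (n_i + n_j - n_k) / 2`, where `{i, j, k} = {1, 2, 3}`.
It is only used for triples with an even sum, where the division is exact. -/
def prime (n : Triple) (k : Fin 3) : ℤ := twicePrime n k / 2

/-- The triple `r` with `r_a = r'_b + r'_c` for `{a, b, c} = {1, 2, 3}`, recovered from `r'`. -/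
def unprime (r' : Triple) (a : Fin 3) : ℤ := total r' - r' a

/-- Sum of the squares of the entries. -/
def normSq (n : Triple) : ℤ := ∑ a, n a ^ 2

/-- Dot product of two triples. -/
def dot (m n : Triple) : ℤ := ∑ a, m a * n a

/-- Admissible triples: nonnegative entries, even sum, triangle inequalities. -/
def Admissible (l : Triple) : Prop :=
  (∀ a, 0 ≤ l a) ∧ Even (total l) ∧
    l 0 ≤ l 1 + l 2 ∧ l 1 ≤ l 0 + l 2 ∧ l 2 ≤ l 0 + l 1

/-- The triple `l + a δ^i + b δ^j`. -/
def shift (l : Triple) (i j : Fin 3) (a b : ℤ) : Triple :=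
  l + Pi.single i a + Pi.single j b

/-- The two signs `+1` and `-1`. -/
def signs : Finset ℤ := {1, -1}

/-- The triples `k` of nonnegative integers with `|k| ≤ |l|`. -/
def kSet (l : Triple) : Set Triple :=
  {k | (∀ a, 0 ≤ k a) ∧ total k ≤ total l}

theorem kSet_finite (l : Triple) : (kSet l).Finite := by
  refine (Set.finite_Icc (0 : Triple) (fun _ => total l)).subset ?_
  rintro k ⟨h0, h1⟩
  refine ⟨fun a => h0 a, fun a => ?_⟩
  have h2 : k a ≤ ∑ b, k b :=
    Finset.single_le_sum (f := k) (fun b _ => h0 b) (Finset.mem_univ a)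
  exact h2.trans h1

/-- The lattice points `(r', s, n)` of the polytope `Δ(k | l)`. The entry `r' c` stands for
`r_{ab}`, where `{a, b, c} = {1, 2, 3}`, and `unprime r' a` is `r_a = r_{ab} + r_{ac}`. -/
def polytope (k l : Triple) : Set (Triple × ℤ × Triple) :=
  {p | (∀ a, 0 ≤ p.1 a) ∧ 0 ≤ p.2.1 ∧ (∀ a, 0 ≤ p.2.2 a) ∧
    (∀ c, twicePrime k c - prime l c ≤ p.1 c) ∧
    ∀ a, unprime p.1 a ≤ p.2.2 a ∧ p.2.2 a ≤ k a - p.2.1}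

theorem polytope_finite (k l : Triple) : (polytope k l).Finite := by
  refine ((Set.finite_Icc (0 : Triple) (fun _ => k 0 + k 1 + k 2)).prod
    ((Set.finite_Icc (0 : ℤ) (k 0)).prod (Set.finite_Icc (0 : Triple) k))).subset ?_
  rintro ⟨r, s, n⟩ ⟨hr, hs, hn, -, h⟩
  simp only [unprime, total, Fin.sum_univ_three] at hr hs hn h
  have := hr 0
  have := hr 1
  have := hr 2
  have := hn 0
  have := hn 1
  have := hn 2
  have := h 0
  have := h 1
  have := h 2
  refine ⟨⟨fun a => hr a, fun a => ?_⟩, ⟨hs, ?_⟩, ⟨fun a => hn a, fun a => ?_⟩⟩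
  · fin_cases a <;> simp <;> omega
  · simp only
    omega
  · have := h a
    simp only
    omega

noncomputable section

variable {K : Type*} [Field K]

/-- `q` and `t` are nonzero and no nontrivial monomial in them equals `1`.
The two variables of a rational function field such as `ℂ(q, t)` are of this kind. -/
def Generic (q t : K) : Prop :=
  q ≠ 0 ∧ t ≠ 0 ∧ ∀ m n : ℤ, q ^ m * t ^ n = 1 → m = 0 ∧ n = 0

/-- The `q`-Pochhammer symbol `(x; p)_n = ∏_{0 ≤ k < n} (1 - p^k x)`. It is only used
with `n ≥ 0`. -/
def qPoch (x p : K) (n : ℤ) : K := ∏ k ∈ range n.toNat, (1 - p ^ k * x)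

/-- Laurent polynomials in `x_{23}, x_{13}, x_{12}`. The variable `x_{ij}` is indexed by the
element `k` of `Fin 3` with `{i, j, k} = {1, 2, 3}`. -/
abbrev Laurent (K : Type*) [Field K] := AddMonoidAlgebra K Triple

/-- The element `x_{ij} + x_{ij}⁻¹`, where `{i, j, k} = {1, 2, 3}`. -/
def xPlusInv (K : Type*) [Field K] (k : Fin 3) : Laurent K :=
  AddMonoidAlgebra.single (Pi.single k 1) 1 + AddMonoidAlgebra.single (Pi.single k (-1)) 1

/-- The coefficient `C_{l,k}(r', s, n)`. -/
def coeffC (q t : K) (l k : Triple) (r' : Triple) (s : ℤ) (n : Triple) : K :=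
  let r : Triple := unprime r'
  (-1) ^ s * (q ^ 2 * t⁻¹) ^ (total l + total r - total k + 2 * s)
      * q ^ (total n ^ 2 - total r ^ 2 + 3 * normSq r - normSq n - 2 * dot r n
          + (s + 1) * (s + 2 * (total n - total r)))
      / (qPoch (q ^ 2) (q ^ 2) s
          * qPoch (q ^ 2 * t ^ 2) (q ^ 2) (total n + total l / 2 - total k + 3 * s))
    * ∏ a, q ^ (2 * (n a - r a) * (prime l a - twicePrime k a))
        * (qPoch (t ^ 2) (q ^ 2) (n a + l a - k a + s)
            * qPoch (q ^ (-2 * l a)) (q ^ 2) (n a + l a - k a + s))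
        / (qPoch (q ^ 2) (q ^ 2) (n a - r a) * qPoch (q ^ 2) (q ^ 2) (r' a)
            * qPoch (q ^ 2) (q ^ 2) (prime l a + r' a - twicePrime k a))

open Classical in
/-- The polynomial `φ_l` for admissible `l`, and `0` for other triples. The exponent of
`x_{ab}` in the monomial that belongs to `k` is `l_{ab} - 2 k_{ab}`. -/
def phi (q t : K) (l : Triple) : Laurent K :=
  if Admissible l then
    ∑ k ∈ (kSet_finite l).toFinset, ∑ p ∈ (polytope_finite k l).toFinset,
      AddMonoidAlgebra.single (fun c => prime l c - twicePrime k c)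
        (coeffC q t l k p.1 p.2.1 p.2.2)
  else 0

/-- The prefactor in the Pieri rule for `φ_l`. -/
def pieriPrefactor (q t : K) (l : Triple) (i j : Fin 3) : K :=
  ((1 - q ^ (2 * l i)) * (1 - q ^ (2 * l j)))
    / ((1 - t ^ 2 * q ^ (2 * l i)) * (1 - t ^ 2 * q ^ (2 * l j)))

/-- The coefficients `Ã_{a,b}` in the Pieri rule for `φ_l` and multiplication by
`x_{ij} + x_{ij}⁻¹`, where `{i, j, k} = {1, 2, 3}` and `a, b ∈ {1, -1}`. -/
def pieriA (q t : K) (l : Triple) (i j k : Fin 3) (a b : ℤ) : K :=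
  if a = 1 then
    if b = 1 then
      t ^ 2 * q ^ (2 * (l i + l j))
        * ((1 - t ^ 2 * q ^ (total l + 2)) * (1 - q ^ (2 * (prime l k + 1))))
        / ((1 - q ^ (2 * l i)) * (1 - q ^ (2 * l j))
            * (1 - q ^ (2 * (l i + 1))) * (1 - q ^ (2 * (l j + 1))))
    else
      t * q ^ (2 * (l i - prime l i + 1))
        * ((1 - t ^ 2 * q ^ (2 * (prime l i - 1))) * (1 - q ^ (2 * (prime l j + 1))))
        / ((1 - q ^ (2 * l i)) * (1 - q ^ (2 * (l i + 1))))
  else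
    if b = 1 then
      t * q ^ (2 * (l j - prime l j + 1))
        * ((1 - t ^ 2 * q ^ (2 * (prime l j - 1))) * (1 - q ^ (2 * (prime l i + 1))))
        / ((1 - q ^ (2 * l j)) * (1 - q ^ (2 * (l j + 1))))
    else
      t ^ (-2 : ℤ) * q ^ (2 * (2 - l i - l j))
        * ((1 - t ^ 4 * q ^ (total l - 2)) * (1 - t ^ 2 * q ^ (2 * (prime l k - 1))))

/-- The product of `pieriPrefactor` and `pieriA` after cancelling the factors `1 - q^{2 l_i}` and
`1 - q^{2 l_j}` that the two have in common. In this form it makes sense for `l_i = 0` and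
`l_j = 0` too. -/
def pieriCoeff (q t : K) (l : Triple) (i j k : Fin 3) (a b : ℤ) : K :=
  (if a = 1 then
    if b = 1 then
      t ^ 2 * q ^ (2 * (l i + l j))
        * ((1 - t ^ 2 * q ^ (total l + 2)) * (1 - q ^ (2 * (prime l k + 1))))
        / ((1 - q ^ (2 * (l i + 1))) * (1 - q ^ (2 * (l j + 1))))
    else
      t * q ^ (2 * (l i - prime l i + 1))
        * ((1 - t ^ 2 * q ^ (2 * (prime l i - 1))) * (1 - q ^ (2 * (prime l j + 1))))
        * (1 - q ^ (2 * l j)) / (1 - q ^ (2 * (l i + 1)))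
  else
    if b = 1 then
      t * q ^ (2 * (l j - prime l j + 1))
        * ((1 - t ^ 2 * q ^ (2 * (prime l j - 1))) * (1 - q ^ (2 * (prime l i + 1))))
        * (1 - q ^ (2 * l i)) / (1 - q ^ (2 * (l j + 1)))
    else
      t ^ (-2 : ℤ) * q ^ (2 * (2 - l i - l j))
        * ((1 - t ^ 4 * q ^ (total l - 2)) * (1 - t ^ 2 * q ^ (2 * (prime l k - 1))))
        * ((1 - q ^ (2 * l i)) * (1 - q ^ (2 * l j))))
    / ((1 - t ^ 2 * q ^ (2 * l i)) * (1 - t ^ 2 * q ^ (2 * l j)))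

/-- `[n, m]_{q,t} = (q^n t^m - q^{-n} t^{-m}) / (q - q^{-1})`. -/
def bracket (q t : K) (n m : ℤ) : K :=
  (q ^ n * t ^ m - q ^ (-n) * t ^ (-m)) / (q - q⁻¹)

/-- The coefficient `C_{a,b}(l)` of the Arthamonov–Shakirov Pieri rule for multiplication by
`x_{ij} + x_{ij}⁻¹`, where `{i, j, k} = {1, 2, 3}` and `a, b ∈ {1, -1}`. -/
def asCoeff (q t : K) (l : Triple) (i j k : Fin 3) (a b : ℤ) : K :=
  (a : K) * (b : K)
    * (bracket q t ((a * l i + b * l j + l k) / 2) ((a + b + 2) / 2)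
        * bracket q t ((a * l i + b * l j - l k) / 2) ((a + b) / 2)
        * bracket q t (l i - 1) 2 * bracket q t (l j - 1) 2)
    / (bracket q t (l i) ((a + 3) / 2) * bracket q t (l i - 1) ((a + 3) / 2)
        * bracket q t (l j) ((b + 3) / 2) * bracket q t (l j - 1) ((b + 3) / 2))

/-- The defining properties of the family of genus 2 Macdonald polynomials of Arthamonov and
Shakirov: the initial data and the Pieri rules for all permutations `(i, j, k)` of the indices. -/
def IsGenusTwoMacdonald (q t : K) (Φ : Triple → Laurent K) : Prop :=
  Φ 0 = 1 ∧ (∀ l, ¬ Admissible l → Φ l = 0) ∧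
    ∀ l, Admissible l → ∀ i j k : Fin 3, i ≠ j → k ≠ i → k ≠ j →
      xPlusInv K k * Φ l
        = ∑ a ∈ signs, ∑ b ∈ signs, asCoeff q t l i j k a b • Φ (shift l i j a b)

/-- The factor `N_{X_7}(l)`. -/
def normX7 (q t : K) (l : Triple) : K :=
  q ^ normSq l * qPoch (t ^ 2 * q ^ 2) (q ^ 2) (total l / 2)
    * ∏ a, qPoch (q ^ 2) (q ^ 2) (prime l a)
        / (qPoch (q ^ 2) (q ^ 2) (l a) * qPoch (t ^ 2) (q ^ 2) (l a))

/-- The factor `N_{AS}(l)`. -/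
def normAS (q t : K) (l : Triple) : K :=
  qPoch (t ^ 4) (q ^ 2) (total l / 2)
    * ∏ a, qPoch (t ^ 2) (q ^ 2) (prime l a) / qPoch (t ^ 4) (q ^ 2) (l a)

end

end GenusTwo

namespace GenusTwo

open Finset

set_option linter.unusedSimpArgs false
set_option linter.unnecessarySeqFocus false

noncomputable section

variable {K : Type*} [Field K]

/-! Write the given triple as `unprime l`, so that `l` carries the numbers l_{ab}. Admissibility
becomes nonnegativity of the entries of `l`, and the four shifts by ±δ^i ± δ^j become the shifts of
`l` by ±δ^k and ±(δ^i - δ^j).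

The substitution m = n + `unprime l` - k + s, p = n - `unprime r'` disentangles the sum that defines
φ. The sum over r' is a product of three continuous q-Hermite polynomials, the sum over (p, s) of
such products is a polynomial `gPoly`, and φ becomes a combination `phiExt` of the `gPoly` whose
coefficients `phiCoeff` are pure products (`coeffC_eq`, `phi_unprime`). The three-term recurrence of
the q-Hermite polynomials, together with contiguity relations in p and s, yields a five-term rule
for multiplying `gPoly` by x + 1/x (`xPlusInv_mul_gPoly`). Inserted into `phiExt`, it reduces the
Pieri rule to a comparison of the coefficients of each `gPoly` (`phiCoeff_pieri`). After division by
common Pochhammer symbols, this is a single identity of rational functions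
(`phiExt_pieri_rational`).

The argument needs only that `unprime l` is nonnegative, so it gives a Pieri rule for `phiExt` also
where the triangle inequalities fail. To return to φ, which is 0 there by definition, one shows that
`phiExt` vanishes there as well (`phiExt_eq_zero`). On the axis (-d, d, d) this is a telescoping
sum, and the Pieri rule itself propagates the vanishing from the axis.

For the second claim, `normRatio` factors into functions of one integer each, and the successor
formulas of these functions conjugate one set of Pieri coefficients into the other
(`asCoeff_mul_normRatio_shift`). This gives existence. Uniqueness holds because the coefficient of
the highest term is nonzero, so that the Pieri rule determines the family by induction on the
degree. -/

/-! ### Sums and products over three distinct indices -/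

/-- The monoid structure of sums and products over `Fin 3` along distinct indices. -/
theorem sum_distinct {M : Type*} [AddCommMonoid M] {i j k : Fin 3} (hij : i ≠ j) (hki : k ≠ i)
    (hkj : k ≠ j) (f : Fin 3 → M) : ∑ a, f a = f i + f j + f k := by
  have h : (univ : Finset (Fin 3)) = {i, j, k} := by decide +revert
  rw [h, sum_insert (by simp [hij, hki.symm]), sum_insert (by simp [hkj.symm]), sum_singleton,
    add_assoc]

theorem prod_distinct {M : Type*} [CommMonoid M] {i j k : Fin 3} (hij : i ≠ j) (hki : k ≠ i)
    (hkj : k ≠ j) (f : Fin 3 → M) : ∏ a, f a = f i * f j * f k := by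
  have h : (univ : Finset (Fin 3)) = {i, j, k} := by decide +revert
  rw [h, prod_insert (by simp [hij, hki.symm]), prod_insert (by simp [hkj.symm]), prod_singleton,
    mul_assoc]

theorem eq_or_of_distinct {i j k : Fin 3} (hij : i ≠ j) (hki : k ≠ i) (hkj : k ≠ j) (c : Fin 3) :
    c = i ∨ c = j ∨ c = k := by
  decide +revert

theorem triple_ext {i j k : Fin 3} (hij : i ≠ j) (hki : k ≠ i) (hkj : k ≠ j) {m n : Triple}
    (h₁ : m i = n i) (h₂ : m j = n j) (h₃ : m k = n k) : m = n := by
  funext c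
  rcases eq_or_of_distinct hij hki hkj c with rfl | rfl | rfl <;> assumption

/-! ### Pochhammer symbols and their reciprocals -/

/-- `1 / (p; p)_n`, which is `0` for negative `n`. -/
def invPoch (p : K) (n : ℤ) : K := if n < 0 then 0 else (qPoch p p n)⁻¹

theorem qPoch_zero (x p : K) : qPoch x p 0 = 1 := by simp [qPoch]

theorem qPoch_succ (x p : K) {n : ℤ} (hn : 0 ≤ n) :
    qPoch x p (n + 1) = qPoch x p n * (1 - p ^ n * x) := by
  obtain ⟨n, rfl⟩ := Int.eq_ofNat_of_zero_le hn
  have h : ((n : ℤ) + 1).toNat = n + 1 := by omega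
  simp [qPoch, h, prod_range_succ]

theorem qPoch_succ' (x p : K) {n : ℤ} (hn : 0 ≤ n) :
    qPoch x p (n + 1) = (1 - x) * qPoch (p * x) p n := by
  obtain ⟨n, rfl⟩ := Int.eq_ofNat_of_zero_le hn
  have h : ((n : ℤ) + 1).toNat = n + 1 := by omega
  simp [qPoch, h, prod_range_succ', pow_succ, mul_assoc, mul_comm]

/-- `p` is nonzero and not a root of unity. -/
def NotRootOfUnity (p : K) : Prop := p ≠ 0 ∧ ∀ n : ℤ, p ^ n = 1 → n = 0

/-- With the value 0 at negative arguments the recursion holds for every integer: at n = -1 the left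
factor is 1 - p^0 = 0. Sums can therefore run over all integers and be translated without boundary
terms. -/
theorem invPoch_succ {p : K} (hp : NotRootOfUnity p) (n : ℤ) :
    (1 - p ^ (n + 1)) * invPoch p (n + 1) = invPoch p n := by
  rcases lt_trichotomy n (-1) with h | rfl | h
  · rw [invPoch, invPoch, if_pos (by omega), if_pos (by omega), mul_zero]
  · simp [invPoch]
  · have h1 : 1 - p ^ (n + 1) ≠ 0 := fun h2 => by
      have := hp.2 _ (sub_eq_zero.mp h2).symm
      omega
    rw [invPoch, invPoch, if_neg (by omega), if_neg (by omega), qPoch_succ _ _ (by omega),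
      show p ^ n * p = p ^ (n + 1) by rw [zpow_add₀ hp.1, zpow_one], mul_inv]
    field_simp

theorem one_sub_mul_invPoch {p : K} (hp : NotRootOfUnity p) (n : ℤ) :
    (1 - p ^ n) * invPoch p n = invPoch p (n - 1) := by
  simpa using invPoch_succ hp (n - 1)

theorem invPoch_of_neg (p : K) {n : ℤ} (hn : n < 0) : invPoch p n = 0 := if_pos hn

theorem invPoch_of_nonneg (p : K) {n : ℤ} (hn : 0 ≤ n) : invPoch p n = (qPoch p p n)⁻¹ :=
  if_neg (by omega)

/-! ### Continuous q-Hermite polynomials -/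

/-- The term of the continuous `q`-Hermite polynomial in `x_a`. -/
def hermiteTerm (p : K) (a : Fin 3) (n r : ℤ) : Laurent K :=
  AddMonoidAlgebra.single (Pi.single a (n - 2 * r)) (invPoch p r * invPoch p (n - r))

theorem hermiteTerm_support (p : K) (a : Fin 3) (n : ℤ) :
    Function.support (hermiteTerm p a n) ⊆ ↑(Icc 0 n) := by
  intro r hr
  by_contra h
  apply hr
  rw [coe_Icc, Set.mem_Icc, not_and_or, not_le, not_le] at h
  rcases h with h | h
  · simp [hermiteTerm, invPoch_of_neg p h]
  · simp [hermiteTerm, invPoch_of_neg p (show n - r < 0 by omega)]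

theorem hermiteTerm_finite (p : K) (a : Fin 3) (n : ℤ) :
    Function.HasFiniteSupport (hermiteTerm p a n) :=
  (Icc 0 n).finite_toSet.subset (hermiteTerm_support p a n)

/-- The continuous `q`-Hermite polynomial in `x_a`, divided by `(p; p)_n`. -/
def hermite (p : K) (a : Fin 3) (n : ℤ) : Laurent K := ∑ᶠ r, hermiteTerm p a n r

theorem hermite_eq_sum (p : K) (a : Fin 3) (n : ℤ) :
    hermite p a n = ∑ r ∈ Icc 0 n, hermiteTerm p a n r :=
  finsum_eq_sum_of_support_subset _ (hermiteTerm_support p a n)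

theorem hermite_of_neg (p : K) (a : Fin 3) {n : ℤ} (hn : n < 0) : hermite p a n = 0 := by
  rw [hermite_eq_sum, Icc_eq_empty (by omega), sum_empty]

/-- The r-th term times x and the (r-1)-st term times 1/x have the same monomial. With a = p^r and b
= p^(n+1-r), comparing coefficients amounts to (1 - b) + (1 - a) = (1 - ab) + (1 - a)(1 - b). -/
theorem xPlusInv_mul_hermite {p : K} (hp : NotRootOfUnity p) (a : Fin 3) (n : ℤ) :
    xPlusInv K a * hermite p a n
      = (1 - p ^ (n + 1)) • hermite p a (n + 1) + hermite p a (n - 1) := by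
  have key : ∀ r, AddMonoidAlgebra.single (Pi.single a 1) (1 : K) * hermiteTerm p a n r
        + AddMonoidAlgebra.single (Pi.single a (-1)) (1 : K) * hermiteTerm p a n (r - 1)
      = (1 - p ^ (n + 1)) • hermiteTerm p a (n + 1) r + hermiteTerm p a (n - 1) (r - 1) := by
    intro r
    simp only [hermiteTerm, AddMonoidAlgebra.single_mul_single, one_mul,
      AddMonoidAlgebra.smul_single, ← Pi.single_add, smul_eq_mul]
    rw [show 1 + (n - 2 * r) = n + 1 - 2 * r by ring,
      show -1 + (n - 2 * (r - 1)) = n + 1 - 2 * r by ring,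
      show n - 1 - 2 * (r - 1) = n + 1 - 2 * r by ring, ← AddMonoidAlgebra.single_add,
      ← AddMonoidAlgebra.single_add]
    congr 1
    rw [show n - 1 - (r - 1) = n + 1 - r - 1 by ring, show n - (r - 1) = n + 1 - r by ring,
      show n - r = n + 1 - r - 1 by ring, ← one_sub_mul_invPoch hp r,
      ← one_sub_mul_invPoch hp (n + 1 - r),
      show p ^ (n + 1) = p ^ r * p ^ (n + 1 - r) by rw [← zpow_add₀ hp.1]; congr 1; ring]
    ring
  have shift : ∀ m, hermite p a m = ∑ᶠ r, hermiteTerm p a m (r - 1) := fun m =>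
    (finsum_comp_equiv (Equiv.subRight (1 : ℤ)) (f := hermiteTerm p a m)).symm
  have shift_finite : ∀ m, Function.HasFiniteSupport fun r => hermiteTerm p a m (r - 1) := fun m =>
    (hermiteTerm_finite p a m).preimage (Equiv.subRight (1 : ℤ)).injective.injOn
  have mul_finite : ∀ (y : Laurent K) (f : ℤ → Laurent K), Function.HasFiniteSupport f →
      Function.HasFiniteSupport fun r => y * f r := fun y f hf =>
    hf.subset fun r hr h => hr (by simp [h])
  have smul_finite : ∀ (y : K) (f : ℤ → Laurent K), Function.HasFiniteSupport f →
      Function.HasFiniteSupport fun r => y • f r := fun y f hf =>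
    hf.subset fun r hr h => hr (by simp [h])
  rw [xPlusInv, add_mul, shift (n - 1)]
  nth_rewrite 2 [shift n]
  rw [hermite, hermite, mul_finsum' _ _ (hermiteTerm_finite p a n),
    mul_finsum' _ _ (shift_finite n), smul_finsum' _ (hermiteTerm_finite p a _),
    ← finsum_add_distrib (mul_finite _ _ (hermiteTerm_finite p a n))
      (mul_finite _ _ (shift_finite n)),
    ← finsum_add_distrib (smul_finite _ _ (hermiteTerm_finite p a _)) (shift_finite _)]
  exact finsum_congr key

/-- The product of the three `q`-Hermite polynomials of degrees `h`. -/
def hermiteProd (p : K) (h : Triple) : Laurent K := ∏ a, hermite p a (h a)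

theorem hermiteProd_of_neg (p : K) {h : Triple} {a : Fin 3} (ha : h a < 0) :
    hermiteProd p h = 0 :=
  prod_eq_zero (mem_univ a) (hermite_of_neg p a ha)

theorem xPlusInv_mul_hermiteProd {p : K} (hp : NotRootOfUnity p) (k : Fin 3) (h : Triple) :
    xPlusInv K k * hermiteProd p h = (1 - p ^ (h k + 1)) • hermiteProd p (h + Pi.single k 1)
      + hermiteProd p (h - Pi.single k 1) := by
  obtain ⟨i, j, hij, hki, hkj⟩ : ∃ i j : Fin 3, i ≠ j ∧ k ≠ i ∧ k ≠ j := by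
    clear h; decide +revert
  simp only [hermiteProd, prod_distinct hij hki hkj, Pi.add_apply, Pi.sub_apply,
    Pi.single_eq_same, Pi.single_eq_of_ne hki.symm, Pi.single_eq_of_ne hkj.symm, add_zero, sub_zero]
  rw [mul_left_comm, xPlusInv_mul_hermite hp, mul_add, mul_smul_comm]

theorem hermiteProd_eq_sum (p : K) (h : Triple) :
    hermiteProd p h = ∑ r ∈ Icc 0 h, AddMonoidAlgebra.single (fun c => h c - 2 * r c)
      (∏ c, invPoch p (r c) * invPoch p (h c - r c)) := by
  simp only [hermiteProd, hermite_eq_sum]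
  rw [prod_univ_sum]
  refine sum_congr rfl fun r _ => ?_
  simp only [hermiteTerm, Fin.prod_univ_three, AddMonoidAlgebra.single_mul_single]
  congr 1
  funext c
  fin_cases c <;> simp

theorem Generic.q_ne_zero {q t : K} (h : Generic q t) : q ≠ 0 := h.1

theorem Generic.t_ne_zero {q t : K} (h : Generic q t) : t ≠ 0 := h.2.1

theorem Generic.notRootOfUnity {q t : K} (h : Generic q t) : NotRootOfUnity (q ^ 2) := by
  refine ⟨pow_ne_zero 2 h.1, fun n hn => ?_⟩
  have := (h.2.2 (2 * n) 0 (by rw [zpow_zero, mul_one, zpow_mul]; exact_mod_cast hn)).1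
  omega

theorem q_sq_zpow (q : K) (n : ℤ) : (q ^ 2) ^ n = q ^ (2 * n) := by
  rw [zpow_mul]; norm_cast

/-! ### Weighted sums of q-Hermite products and their contiguity relations -/

/-- The degrees of the `q`-Hermite polynomials in the summand indexed by `(p, s)`. -/
def hermiteIdx (ν : Triple) (x : Triple × ℤ) : Triple :=
  fun a => ν a + 2 * x.1 a - total x.1 - x.2

/-- The weight of the summand indexed by `(p, s)`. -/
def weight (q t : K) (p : Triple) (s : ℤ) (h : Triple) : K :=
  t ^ (total p + s) * (-1) ^ s
    * q ^ (total p ^ 2 - normSq p + 2 * dot p h + 2 * s * total p + s * (s - 1))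
    * (invPoch (q ^ 2) s * ∏ a, invPoch (q ^ 2) (p a))

/-- The summand of `moment`. -/
def momentTerm (q t : K) (ν c : Triple) (d : ℤ) (x : Triple × ℤ) : Laurent K :=
  (q ^ (2 * (dot c x.1 + d * x.2)) * weight q t x.1 x.2 (hermiteIdx ν x))
    • hermiteProd (q ^ 2) (hermiteIdx ν x)

/-- For distinct a, b, c the degrees satisfy h_a + h_b = ν_a + ν_b - 2 p_c - 2 s, so nonnegative
degrees bound p and s. -/
theorem hermiteIdx_region_finite (ν : Triple) :
    {x : Triple × ℤ | (∀ a, 0 ≤ x.1 a) ∧ 0 ≤ x.2 ∧ ∀ a, 0 ≤ hermiteIdx ν x a}.Finite := by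
  refine ((Set.finite_Icc (0 : Triple) (fun _ => |ν 0| + |ν 1| + |ν 2|)).prod
    (Set.finite_Icc (0 : ℤ) (|ν 0| + |ν 1| + |ν 2|))).subset ?_
  rintro ⟨p, s⟩ ⟨hp, hs, hh⟩
  simp only [hermiteIdx, total, Fin.sum_univ_three] at hp hs hh
  have := hp 0
  have := hp 1
  have := hp 2
  have := hh 0
  have := hh 1
  have := hh 2
  have := le_abs_self (ν 0)
  have := le_abs_self (ν 1)
  have := le_abs_self (ν 2)
  have := abs_nonneg (ν 0)
  have := abs_nonneg (ν 1)
  have := abs_nonneg (ν 2)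
  refine ⟨⟨hp, fun a => ?_⟩, hs, ?_⟩
  · fin_cases a <;> simp <;> omega
  · simp only
    omega

theorem momentTerm_support (q t : K) (ν c : Triple) (d : ℤ) :
    Function.support (momentTerm q t ν c d)
      ⊆ {x | (∀ a, 0 ≤ x.1 a) ∧ 0 ≤ x.2 ∧ ∀ a, 0 ≤ hermiteIdx ν x a} := by
  intro x hx
  refine ⟨fun a => ?_, ?_, fun a => ?_⟩ <;> by_contra! h <;> apply hx
  · rw [momentTerm, weight, prod_eq_zero (mem_univ a) (invPoch_of_neg _ h)]
    simp
  · rw [momentTerm, weight, invPoch_of_neg _ h]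
    simp
  · rw [momentTerm, hermiteProd_of_neg _ h, smul_zero]

theorem momentTerm_finite (q t : K) (ν c : Triple) (d : ℤ) :
    Function.HasFiniteSupport (momentTerm q t ν c d) :=
  (hermiteIdx_region_finite ν).subset (momentTerm_support q t ν c d)

/-- The sum over `(p, s)` of the products of `q`-Hermite polynomials with the given weights,
twisted by `q^{2 (c · p + d s)}`. -/
def moment (q t : K) (ν c : Triple) (d : ℤ) : Laurent K := ∑ᶠ x, momentTerm q t ν c d x

theorem smul_finite {ι : Type*} {f : ι → Laurent K} (hf : Function.HasFiniteSupport f) (y : K) :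
    Function.HasFiniteSupport fun x => y • f x :=
  hf.subset fun x hx h => hx (by simp [h])

theorem moment_eq_shift (q t : K) (ν c : Triple) (d : ℤ) (v : Triple × ℤ) :
    moment q t ν c d = ∑ᶠ x, momentTerm q t ν c d (x - v) :=
  (finsum_comp_equiv (Equiv.subRight v)).symm

theorem momentTerm_shift_finite (q t : K) (ν c : Triple) (d : ℤ) (v : Triple × ℤ) :
    Function.HasFiniteSupport fun x => momentTerm q t ν c d (x - v) :=
  (momentTerm_finite q t ν c d).preimage (Equiv.subRight v).injective.injOn

theorem exists_distinct (k : Fin 3) : ∃ i j : Fin 3, i ≠ j ∧ k ≠ i ∧ k ≠ j := by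
  decide +revert

/-- The difference of the two twists inserts the factor 1 - q^{2 p_a}, which turns 1/(q²;q²)_{p_a}
into the same symbol at p_a - 1. Translating p_a by 1 then keeps the Hermite degrees if ν is moved
to ν + 2δ^a - (1, 1, 1). -/
theorem moment_sub_p {q t : K} (hqt : Generic q t) (ν c : Triple) (d : ℤ) (a : Fin 3) :
    moment q t ν c d - moment q t ν (c + Pi.single a 1) d
      = (t * q ^ (2 * (ν a + 1 + c a)))
        • moment q t (ν + Pi.single a 2 - 1) (c + Pi.single a 1) d := by
  obtain ⟨i, j, hij, hki, hkj⟩ := exists_distinct a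
  have hq := hqt.q_ne_zero
  have ht := hqt.t_ne_zero
  rw [moment_eq_shift q t (ν + Pi.single a 2 - 1) _ _ (Pi.single a 1, 0),
    smul_finsum' _ (momentTerm_shift_finite _ _ _ _ _ _), moment, moment,
    ← finsum_sub_distrib (momentTerm_finite _ _ _ _ _) (momentTerm_finite _ _ _ _ _)]
  refine finsum_congr fun x => ?_
  obtain ⟨p, s⟩ := x
  have hidx : hermiteIdx (ν + Pi.single a 2 - 1) ((p, s) - (Pi.single a 1, 0))
      = hermiteIdx ν (p, s) := by
    refine triple_ext hij hki hkj ?_ ?_ ?_ <;>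
    simp [hermiteIdx, total, sum_distinct hij hki hkj, hki, hkj, hki.symm, hkj.symm] <;> ring
  rw [momentTerm, momentTerm, momentTerm, hidx, ← sub_smul, smul_smul]
  congr 1
  have hh : hermiteIdx ν (p, s) a = ν a + p a - p i - p j - s := by
    simp [hermiteIdx, total, sum_distinct hij hki hkj]; ring
  generalize hermiteIdx ν (p, s) = h at hh
  have h1 : invPoch (q ^ 2) (p a - 1) = (1 - q ^ (2 * p a)) * invPoch (q ^ 2) (p a) := by
    rw [← one_sub_mul_invPoch hqt.notRootOfUnity, q_sq_zpow]
  simp only [weight, total, normSq, dot, sum_distinct hij hki hkj, prod_distinct hij hki hkj,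
    Prod.fst_sub, Prod.snd_sub, Pi.sub_apply, Pi.add_apply, Pi.single_eq_same,
    Pi.single_eq_of_ne hki.symm, Pi.single_eq_of_ne hkj.symm, sub_zero, add_zero, h1]
  rw [show p i + p j + p a + s = 1 + (p i + p j + (p a - 1) + s) by ring, zpow_add₀ ht, zpow_one]
  -- X and Y will be the exponents in `weight` before and after p_a is lowered; by `hh` their
  -- difference is linear in p and s, and becomes the change of twist.
  have e1 : ∀ X Y : ℤ, 2 * (c i * p i + c j * p j + c a * p a + d * s) + X
      = 2 * (ν a + 1 + c a) + 2 * (c i * p i + c j * p j + (c a + 1) * (p a - 1) + d * s) + Y →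
      q ^ (2 * (c i * p i + c j * p j + c a * p a + d * s)) * q ^ X
        = q ^ (2 * (ν a + 1 + c a))
          * q ^ (2 * (c i * p i + c j * p j + (c a + 1) * (p a - 1) + d * s)) * q ^ Y := by
    intro X Y hXY
    rw [← zpow_add₀ hq, ← zpow_add₀ hq, ← zpow_add₀ hq, hXY]
  have e2 : q ^ (2 * (c i * p i + c j * p j + (c a + 1) * p a + d * s))
      = q ^ (2 * (c i * p i + c j * p j + c a * p a + d * s)) * q ^ (2 * p a) := by
    rw [← zpow_add₀ hq]; congr 1; ring
  rw [e2]
  have e3 := e1 ((p i + p j + p a) ^ 2 - (p i ^ 2 + p j ^ 2 + p a ^ 2)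
      + 2 * (p i * h i + p j * h j + p a * h a) + 2 * s * (p i + p j + p a) + s * (s - 1))
    ((p i + p j + (p a - 1)) ^ 2 - (p i ^ 2 + p j ^ 2 + (p a - 1) ^ 2)
      + 2 * (p i * h i + p j * h j + (p a - 1) * h a) + 2 * s * (p i + p j + (p a - 1))
      + s * (s - 1)) (by rw [hh]; ring)
  linear_combination (t * t ^ (p i + p j + (p a - 1) + s) * (-1) ^ s
    * (invPoch (q ^ 2) s * (invPoch (q ^ 2) (p i) * invPoch (q ^ 2) (p j)
      * ((1 - q ^ (2 * p a)) * invPoch (q ^ 2) (p a))))) * e3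

/-- The same mechanism in s: the factor 1 - q^{2s} lowers s by 1. The cross term 2 s |p| in the
exponent of `weight` produces the twist by (1, 1, 1) in p. -/
theorem moment_sub_s {q t : K} (hqt : Generic q t) (ν c : Triple) (d : ℤ) :
    moment q t ν c d - moment q t ν c (d + 1)
      = (-(t * q ^ (2 * d))) • moment q t (ν - 1) (c + 1) (d + 1) := by
  have hq := hqt.q_ne_zero
  have ht := hqt.t_ne_zero
  rw [moment_eq_shift q t (ν - 1) _ _ (0, 1),
    smul_finsum' _ (momentTerm_shift_finite _ _ _ _ _ _), moment, moment,
    ← finsum_sub_distrib (momentTerm_finite _ _ _ _ _) (momentTerm_finite _ _ _ _ _)]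
  refine finsum_congr fun x => ?_
  obtain ⟨p, s⟩ := x
  have hidx : hermiteIdx (ν - 1) ((p, s) - (0, 1)) = hermiteIdx ν (p, s) := by
    funext a
    simp [hermiteIdx]
    ring
  rw [momentTerm, momentTerm, momentTerm, hidx, ← sub_smul, smul_smul]
  congr 1
  generalize hermiteIdx ν (p, s) = h
  have h1 : invPoch (q ^ 2) (s - 1) = (1 - q ^ (2 * s)) * invPoch (q ^ 2) s := by
    rw [← one_sub_mul_invPoch hqt.notRootOfUnity, q_sq_zpow]
  have h2 : dot (c + 1) p = dot c p + total p := by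
    simp [dot, total, add_mul, sum_add_distrib]
  have h3 : ((-1 : K)) ^ s = -(-1) ^ (s - 1) := by
    rw [zpow_sub₀ (by simp), zpow_one, div_neg, div_one, neg_neg]
  simp only [weight, Prod.fst_sub, Prod.snd_sub, sub_zero, h1, h2, h3]
  rw [show total p + s = 1 + (total p + (s - 1)) by ring, zpow_add₀ ht, zpow_one]
  have e2 : q ^ (2 * (dot c p + (d + 1) * s)) = q ^ (2 * (dot c p + d * s)) * q ^ (2 * s) := by
    rw [← zpow_add₀ hq]; congr 1; ring
  have e3 : q ^ (2 * (dot c p + d * s))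
        * q ^ (total p ^ 2 - normSq p + 2 * dot p h + 2 * s * total p + s * (s - 1))
      = q ^ (2 * d) * q ^ (2 * (dot c p + total p + (d + 1) * (s - 1)))
        * q ^ (total p ^ 2 - normSq p + 2 * dot p h + 2 * (s - 1) * total p
          + (s - 1) * (s - 1 - 1)) := by
    rw [← zpow_add₀ hq, ← zpow_add₀ hq, ← zpow_add₀ hq]
    congr 1; ring
  rw [e2]
  linear_combination (-(t * t ^ (total p + (s - 1)) * (-1) ^ (s - 1)
    * ((1 - q ^ (2 * s)) * invPoch (q ^ 2) s * ∏ a, invPoch (q ^ 2) (p a)))) * e3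

/-- The weight depends on the degrees only through q^{2 p·h}. Moving h_k by ±1 in the Hermite
recurrence therefore costs a power of q^{2 p_k}, which is a twist. The factor 1 - q^{2(h_k+1)} gives
another twist, as h_k is affine in p and s. -/
theorem xPlusInv_mul_moment {q t : K} (hqt : Generic q t) (ν : Triple) {i j k : Fin 3}
    (hij : i ≠ j) (hki : k ≠ i) (hkj : k ≠ j) :
    xPlusInv K k * moment q t ν 0 0
      = moment q t (ν + Pi.single k 1) (Pi.single k (-1)) 0
        - q ^ (2 * (ν k + 1))
          • moment q t (ν + Pi.single k 1) (Pi.single i (-1) + Pi.single j (-1)) (-1)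
        + moment q t (ν - Pi.single k 1) (Pi.single k 1) 0 := by
  have hq := hqt.q_ne_zero
  simp only [moment]
  rw [mul_finsum' _ _ (momentTerm_finite _ _ _ _ _), smul_finsum' _ (momentTerm_finite _ _ _ _ _),
    ← finsum_sub_distrib (momentTerm_finite _ _ _ _ _)
      (smul_finite (momentTerm_finite _ _ _ _ _) _),
    ← finsum_add_distrib _ (momentTerm_finite _ _ _ _ _)]
  swap
  · exact ((momentTerm_finite _ _ _ _ _).union
      (smul_finite (momentTerm_finite q t _ _ _) _)).subset (Function.support_sub _ _)
  refine finsum_congr fun x => ?_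
  obtain ⟨p, s⟩ := x
  have h1 : hermiteIdx (ν + Pi.single k 1) (p, s) = hermiteIdx ν (p, s) + Pi.single k 1 := by
    funext a; simp [hermiteIdx]; ring
  have h2 : hermiteIdx (ν - Pi.single k 1) (p, s) = hermiteIdx ν (p, s) - Pi.single k 1 := by
    funext a; simp [hermiteIdx]; ring
  have hh : hermiteIdx ν (p, s) k = ν k + p k - p i - p j - s := by
    simp [hermiteIdx, total, sum_distinct hij hki hkj]; ring
  simp only [momentTerm, h1, h2]
  rw [mul_smul_comm, xPlusInv_mul_hermiteProd hqt.notRootOfUnity, smul_add, smul_smul, smul_smul,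
    ← sub_smul]
  generalize hermiteIdx ν (p, s) = h at hh
  have w1 : weight q t p s (h + Pi.single k 1) = q ^ (2 * p k) * weight q t p s h := by
    have e : dot p (h + Pi.single k 1) = dot p h + p k := by
      simp [dot, sum_distinct hij hki hkj, hki.symm, hkj.symm]; ring
    rw [weight, weight, e, show total p ^ 2 - normSq p + 2 * (dot p h + p k) + 2 * s * total p
      + s * (s - 1) = 2 * p k + (total p ^ 2 - normSq p + 2 * dot p h + 2 * s * total p
      + s * (s - 1)) by ring, zpow_add₀ hq]
    ring
  have w2 : weight q t p s h = q ^ (2 * p k) * weight q t p s (h - Pi.single k 1) := by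
    have e : dot p (h - Pi.single k 1) = dot p h - p k := by
      simp [dot, sum_distinct hij hki hkj, hki.symm, hkj.symm]; ring
    rw [weight, weight, e, show total p ^ 2 - normSq p + 2 * dot p h + 2 * s * total p
      + s * (s - 1) = 2 * p k + (total p ^ 2 - normSq p + 2 * (dot p h - p k) + 2 * s * total p
      + s * (s - 1)) by ring, zpow_add₀ hq]
    ring
  congr 2
  · rw [w1, q_sq_zpow, hh]
    have d1 : dot (Pi.single k (-1)) p = - p k := by
      simp [dot, sum_distinct hij hki hkj, hki.symm, hkj.symm]
    have d2 : dot (Pi.single i (-1) + Pi.single j (-1)) p = - p i - p j := by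
      simp [dot, sum_distinct hij hki hkj, hki, hkj, hij, hij.symm]; ring
    have d3 : dot 0 p = 0 := by simp [dot]
    rw [d1, d2, d3, show 2 * (ν k + p k - p i - p j - s + 1)
      = 2 * (ν k + 1) + 2 * p k + 2 * (- p i - p j + -1 * s) by ring, zpow_add₀ hq, zpow_add₀ hq,
      show 2 * (-p k + 0 * s) = - (2 * p k) by ring, zpow_neg]
    have := zpow_ne_zero (2 * p k) hq
    field_simp
    simp
  · rw [w2]
    have d1 : dot (Pi.single k 1) p = p k := by
      simp [dot, sum_distinct hij hki hkj, hki.symm, hkj.symm]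
    have d3 : dot 0 p = 0 := by simp [dot]
    rw [d1, d3]
    simp

/-- The unnormalized limiting polynomials, in terms of which `φ_l` has product coefficients. -/
def gPoly (q t : K) (ν : Triple) : Laurent K := moment q t ν 0 0

/-- The twists in `xPlusInv_mul_moment` are removed one at a time by the contiguity relations. A
twisted moment at ν + δ^k - (1, 1, 1) arises both from the removal of the twist in s (`r6`) and from
the last term (`r5`), and the two contributions cancel. -/
theorem xPlusInv_mul_gPoly {q t : K} (hqt : Generic q t) (ν : Triple) {i j k : Fin 3}
    (hij : i ≠ j) (hki : k ≠ i) (hkj : k ≠ j) :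
    xPlusInv K k * gPoly q t ν
      = (1 - q ^ (2 * (ν k + 1))) • gPoly q t (ν + Pi.single k 1)
        + (t * q ^ (2 * (ν k + 1))) • gPoly q t (ν + Pi.single k 3 - 1)
        - (t * q ^ (2 * (ν j + ν k + 1))) • gPoly q t (ν - Pi.single i 1 + Pi.single j 1)
        - (t * q ^ (2 * (ν i + ν k + 1))) • gPoly q t (ν + Pi.single i 1 - Pi.single j 1)
        + (1 - t ^ 2 * q ^ (2 * total ν)) • gPoly q t (ν - Pi.single k 1) := by
  have hq := hqt.q_ne_zero
  have z : ∀ a : Fin 3, (Pi.single a (-1) : Triple) + Pi.single a 1 = 0 := fun a => by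
    rw [← Pi.single_add]; simp
  have r1 := moment_sub_p hqt (ν + Pi.single k 1) (Pi.single k (-1)) 0 k
  have r2 := moment_sub_p hqt (ν + Pi.single k 1) (Pi.single j (-1)) 0 j
  have r3 := moment_sub_p hqt (ν + Pi.single k 1) (Pi.single i (-1) + Pi.single j (-1)) 0 i
  have r4 := moment_sub_p hqt (ν + Pi.single k 1 + Pi.single i 2 - 1) (Pi.single j (-1)) 0 j
  have r5 := moment_sub_p hqt (ν - Pi.single k 1) 0 0 k
  have r6 := moment_sub_s hqt (ν + Pi.single k 1) (Pi.single i (-1) + Pi.single j (-1)) (-1)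
  have c3 : (Pi.single i (-1) + Pi.single j (-1) + Pi.single i 1 : Triple) = Pi.single j (-1) := by
    rw [add_right_comm, z, zero_add]
  have c6 : (Pi.single i (-1) + Pi.single j (-1) + 1 : Triple) = Pi.single k 1 := by
    refine triple_ext hij hki hkj ?_ ?_ ?_ <;>
      simp [hki, hkj, hij, hki.symm, hkj.symm, hij.symm]
  have v1 : ν + Pi.single k 1 + Pi.single k 2 - 1 = ν + Pi.single k 3 - 1 := by
    rw [add_assoc, ← Pi.single_add]; rfl
  have v2 : ν + Pi.single k 1 + Pi.single j 2 - 1 = ν - Pi.single i 1 + Pi.single j 1 := by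
    refine triple_ext hij hki hkj ?_ ?_ ?_ <;>
      simp [hki, hkj, hij, hki.symm, hkj.symm, hij.symm] <;> ring
  have v3 : ν + Pi.single k 1 + Pi.single i 2 - 1 = ν + Pi.single i 1 - Pi.single j 1 := by
    refine triple_ext hij hki hkj ?_ ?_ ?_ <;>
      simp [hki, hkj, hij, hki.symm, hkj.symm, hij.symm] <;> ring
  have v4 : ν + Pi.single i 1 - Pi.single j 1 + Pi.single j 2 - 1 = ν - Pi.single k 1 := by
    refine triple_ext hij hki hkj ?_ ?_ ?_ <;>
      simp [hki, hkj, hij, hki.symm, hkj.symm, hij.symm] <;> ring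
  have v5 : ν - Pi.single k 1 + Pi.single k 2 - 1 = ν + Pi.single k 1 - 1 := by
    refine triple_ext hij hki hkj ?_ ?_ ?_ <;>
      simp [hki, hkj, hij, hki.symm, hkj.symm, hij.symm] <;> ring
  simp only [z, c3, c6, v1, v2, v3, v4, v5, zero_add, Pi.add_apply, Pi.sub_apply,
    Pi.zero_apply, Pi.one_apply, Pi.single_eq_same, Pi.single_eq_of_ne hki.symm, Pi.single_eq_of_ne hkj.symm,
    Pi.single_eq_of_ne hij, Pi.single_eq_of_ne hij.symm, add_zero, neg_add_cancel]
    at r1 r2 r3 r4 r5 r6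
  simp only [gPoly]
  rw [xPlusInv_mul_moment hqt ν hij hki hkj]
  rw [sub_eq_iff_eq_add] at r1 r2 r3 r4 r5 r6
  rw [r1, r6, r3, r2, r4, r5]
  have t1 : total ν = ν i + ν j + ν k := sum_distinct hij hki hkj ν
  have q1 : ∀ n : ℤ, q ^ (2 * (n + 1)) = q ^ 2 * q ^ (2 * n) := fun n => by
    rw [mul_add, zpow_add₀ hq, mul_comm]; norm_cast
  rw [t1]
  match_scalars <;>
    simp only [mul_add, mul_sub, mul_neg, mul_one, zpow_add₀ hq, zpow_sub₀ hq, zpow_neg, zpow_ofNat] <;>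
    field_simp <;> ring

/-! ### The expansion of φ in the polynomials `gPoly` -/

theorem unprime_eq {i j k : Fin 3} (hij : i ≠ j) (hki : k ≠ i) (hkj : k ≠ j) (l : Triple) :
    unprime l i = l j + l k := by
  simp [unprime, total, sum_distinct hij hki hkj]; ring

theorem prime_unprime (l : Triple) (a : Fin 3) : prime (unprime l) a = l a := by
  have : twicePrime (unprime l) a = 2 * l a := by
    fin_cases a <;> simp [twicePrime, unprime, total, Fin.sum_univ_three] <;> ring
  rw [prime, this]
  omega

theorem total_unprime (l : Triple) : total (unprime l) = 2 * total l := by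
  simp [unprime, total, Fin.sum_univ_three]; ring

/-- The product `(t²; q²)_n (q^{-2l}; q²)_n`. -/
def pochPair (q t : K) (l n : ℤ) : K := qPoch (t ^ 2) (q ^ 2) n * qPoch (q ^ (-2 * l)) (q ^ 2) n

theorem pochPair_succ (q t : K) (l : ℤ) {n : ℤ} (hn : 0 ≤ n) :
    pochPair q t l (n + 1)
      = pochPair q t l n * ((1 - q ^ (2 * n) * t ^ 2) * (1 - q ^ (2 * n) * q ^ (-2 * l))) := by
  rw [pochPair, pochPair, qPoch_succ _ _ hn, qPoch_succ _ _ hn, q_sq_zpow]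
  ring

/-- The factors of (q^{-2(l+1)}; q²)_{n+1} after the first are those of (q^{-2l}; q²)_n. -/
theorem pochPair_up {q : K} (hq : q ≠ 0) (t : K) (l : ℤ) {n : ℤ} (hn : 0 ≤ n) :
    pochPair q t (l + 1) (n + 1)
      = pochPair q t l n * ((1 - q ^ (2 * n) * t ^ 2) * (1 - q ^ (-2 * (l + 1)))) := by
  have h : q ^ 2 * q ^ (-2 * (l + 1)) = q ^ (-2 * l) := by
    rw [show -2 * l = 2 + -2 * (l + 1) by ring, zpow_add₀ hq]; norm_cast
  rw [pochPair, pochPair, qPoch_succ _ _ hn, qPoch_succ' _ _ hn, q_sq_zpow, h]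
  ring

/-- Stated with the factor 1 - q^{2l} on the left, so that l = 0 is allowed; this factor is present
in the Pieri coefficients that lower an entry. -/
theorem pochPair_down {q : K} (hq : q ≠ 0) (t : K) (l : ℤ) {n : ℤ} (hn : 0 ≤ n) :
    (1 - q ^ (2 * l)) * pochPair q t (l - 1) n
      = pochPair q t l n * (-q ^ (2 * l) * (1 - q ^ (2 * n) * q ^ (-2 * l))) := by
  have h : q ^ 2 * q ^ (-2 * l) = q ^ (-2 * (l - 1)) := by
    rw [show -2 * (l - 1) = 2 + -2 * l by ring, zpow_add₀ hq]; norm_cast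
  have h1 := qPoch_succ (q ^ (-2 * l)) (q ^ 2) hn
  rw [qPoch_succ' _ _ hn, h, q_sq_zpow] at h1
  have h2 : q ^ (2 * l) * q ^ (-2 * l) = 1 := by
    rw [← zpow_add₀ hq]; simp
  rw [pochPair, pochPair]
  linear_combination (-q ^ (2 * l) * qPoch (t ^ 2) (q ^ 2) n) * h1
    - (qPoch (t ^ 2) (q ^ 2) n * qPoch (q ^ (-2 * (l - 1))) (q ^ 2) n) * h2

/-- The coefficient of `gPoly` in the expansion of `φ`. -/
def phiCoeff (q t : K) (l m : Triple) : K :=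
  (q ^ 2 * t⁻¹) ^ total m * (qPoch (q ^ 2 * t ^ 2) (q ^ 2) (total m - total l))⁻¹
    * ∏ a, pochPair q t (unprime l a) (m a)

/-- The index of `gPoly` that belongs to the summation index `m`. -/
def gIdx (l m : Triple) : Triple := fun a => total m - 2 * m a - l a

/-- The polynomial `φ` at the triple `l` with entries `l_{ab}`, as a combination of the `gPoly`.
It extends `φ` beyond the triangle inequalities. -/
def phiExt (q t : K) (l : Triple) : Laurent K := ∑ᶠ m, phiCoeff q t l m • gPoly q t (gIdx l m)

/-- The degrees in the two other directions add up to `unprime ν a` minus 2 p_a + 2 s, so one of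
them is negative in every summand. -/
theorem gPoly_of_neg (q t : K) {ν : Triple} {a : Fin 3} (h : unprime ν a < 0) :
    gPoly q t ν = 0 := by
  obtain ⟨i, j, hij, hai, haj⟩ := exists_distinct a
  rw [gPoly, moment]
  refine (finsum_congr fun x => ?_).trans finsum_zero
  by_contra hx
  obtain ⟨hp, hs, hh⟩ := momentTerm_support q t ν 0 0 hx
  have h1 := hp a
  have h2 := hh i
  have h3 := hh j
  simp only [hermiteIdx, unprime, total, sum_distinct hij hai haj] at h h2 h3
  omega

theorem qPoch_eq_zero {x p : K} {n m : ℤ} (hm : 0 ≤ m) (hmn : m < n) (h : p ^ m * x = 1) :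
    qPoch x p n = 0 := by
  refine prod_eq_zero (i := m.toNat) (by rw [mem_range]; omega) ?_
  obtain ⟨m, rfl⟩ := Int.eq_ofNat_of_zero_le hm
  rw [Int.toNat_natCast, ← zpow_natCast, h, sub_self]

theorem pochPair_eq_zero {q : K} (hq : q ≠ 0) (t : K) {l n : ℤ} (hl : 0 ≤ l) (hn : l < n) :
    pochPair q t l n = 0 := by
  rw [pochPair, qPoch_eq_zero (x := q ^ (-2 * l)) hl hn, mul_zero]
  rw [q_sq_zpow, ← zpow_add₀ hq]
  simp

/-- The summation over m is cut off above by the vanishing of (q^{-2l}; q²)_n for n > l, and below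
by the vanishing of `gPoly`. -/
theorem phiCoeff_smul_finite {q : K} (hq : q ≠ 0) (t : K) {l : Triple}
    (hl : ∀ a, 0 ≤ unprime l a) (c : Triple → K) (g : Triple → Triple) (C : ℤ)
    (hg : ∀ m a, unprime (g m) a ≤ 2 * m a + C) :
    Function.HasFiniteSupport fun m => (phiCoeff q t l m * c m) • gPoly q t (g m) := by
  refine (Set.finite_Icc (fun _ => -|C| : Triple) (unprime l)).subset fun m hm => ⟨fun a => ?_, fun a => ?_⟩
  · by_contra! h
    refine hm ?_
    have := le_abs_self C
    have := abs_nonneg C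
    have := hg m a
    simp only at h ⊢
    rw [gPoly_of_neg q t (a := a) (by omega), smul_zero]
  · by_contra! h
    refine hm ?_
    simp only
    rw [phiCoeff, prod_eq_zero (mem_univ a) (pochPair_eq_zero hq t (hl a) h)]
    simp

theorem unprime_gIdx (l m : Triple) (a : Fin 3) : unprime (gIdx l m) a = 2 * m a - unprime l a := by
  obtain ⟨i, j, hij, hai, haj⟩ := exists_distinct a
  simp only [unprime, gIdx, total, sum_distinct hij hai haj]
  ring

/-! ### The Pieri rule for `phiExt` -/

/-- The comparison of coefficients in `phiCoeff_pieri` after division by the common Pochhammer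
symbols and powers, with Q = q², L_a = q^{2 l_a}, and x, y, z = q^{2u}, q^{2v}, q^{2w}, where m has
the entries u + 1, v + 1, w. -/
theorem phiExt_pieri_rational {Q t L₁ L₂ L₃ x y z : K} (hQ : Q ≠ 0) (ht : t ≠ 0) (h₁ : L₁ ≠ 0)
    (h₂ : L₂ ≠ 0) (h₃ : L₃ ≠ 0) (hz : z ≠ 0)
    (d₁ : 1 - Q * (L₂ * L₃) ≠ 0) (d₂ : 1 - Q * (L₁ * L₃) ≠ 0)
    (d₃ : 1 - t ^ 2 * (L₂ * L₃) ≠ 0) (d₄ : 1 - t ^ 2 * (L₁ * L₃) ≠ 0) :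
    (1 - Q * x * y / (z * L₃)) * (1 - t ^ 2 * (Q * x * y * z / (L₁ * L₂ * L₃)))
      + Q / t * ((1 - z * t ^ 2) * (1 - z / (L₁ * L₂))) * (t * (x * y / (z * L₃)))
      - Q / t * ((1 - y * t ^ 2) * (1 - y / (L₁ * L₃))) * (t * (Q * x ^ 2 / (L₂ * L₃)))
      - Q / t * ((1 - x * t ^ 2) * (1 - x / (L₂ * L₃))) * (t * (Q * y ^ 2 / (L₁ * L₃)))
      + (Q / t) ^ 2 * ((1 - x * t ^ 2) * (1 - x / (L₂ * L₃)))
        * ((1 - y * t ^ 2) * (1 - y / (L₁ * L₃)))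
    = (t ^ 2 * (L₂ * L₃ * (L₁ * L₃)) * ((1 - t ^ 2 * (Q * (L₁ * L₂ * L₃))) * (1 - Q * L₃))
          / ((1 - Q * (L₂ * L₃)) * (1 - Q * (L₁ * L₃)))
          * ((Q / t) ^ 2 * ((1 - x * t ^ 2) * (1 - 1 / (Q * (L₂ * L₃))))
            * ((1 - y * t ^ 2) * (1 - 1 / (Q * (L₁ * L₃)))))
        + t * (Q * (L₂ * L₃) / L₁) * ((1 - t ^ 2 * (L₁ / Q)) * (1 - Q * L₂))
          / (1 - Q * (L₂ * L₃))
          * (Q / t * ((1 - x * t ^ 2) * (1 - 1 / (Q * (L₂ * L₃))))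
            * (-(L₁ * L₃) * (1 - y / (L₁ * L₃))))
        + t * (Q * (L₁ * L₃) / L₂) * ((1 - t ^ 2 * (L₂ / Q)) * (1 - Q * L₁))
          / (1 - Q * (L₁ * L₃))
          * (Q / t * ((1 - y * t ^ 2) * (1 - 1 / (Q * (L₁ * L₃))))
            * (-(L₂ * L₃) * (1 - x / (L₂ * L₃))))
        + Q ^ 2 / (t ^ 2 * (L₂ * L₃) * (L₁ * L₃))
          * ((1 - t ^ 4 * (L₁ * L₂ * L₃ / Q)) * (1 - t ^ 2 * (L₃ / Q)))
          * (-(L₂ * L₃) * (1 - x / (L₂ * L₃)) * (-(L₁ * L₃) * (1 - y / (L₁ * L₃)))))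
      / ((1 - t ^ 2 * (L₂ * L₃)) * (1 - t ^ 2 * (L₁ * L₃))) := by
  -- The denominators stay opaque while fractions are cleared and are expanded only for the final
  -- polynomial identity.
  generalize hD₁ : 1 - Q * (L₂ * L₃) = D₁ at *
  generalize hD₂ : 1 - Q * (L₁ * L₃) = D₂ at *
  generalize hD₃ : 1 - t ^ 2 * (L₂ * L₃) = D₃ at *
  generalize hD₄ : 1 - t ^ 2 * (L₁ * L₃) = D₄ at *
  field_simp
  subst hD₁ hD₂ hD₃ hD₄
  ring

theorem Generic.one_sub_ne_zero {q t : K} (h : Generic q t) {m n : ℤ} (hmn : m ≠ 0 ∨ n ≠ 0) :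
    1 - q ^ m * t ^ n ≠ 0 := fun h0 => by
  have := h.2.2 m n (sub_eq_zero.mp h0).symm
  tauto

theorem Generic.one_sub_zpow_ne_zero {q t : K} (h : Generic q t) {m : ℤ} (hm : m ≠ 0) :
    1 - q ^ m ≠ 0 := by
  simpa using h.one_sub_ne_zero (n := 0) (Or.inl hm)

theorem Generic.one_sub_sq_mul_ne_zero {q t : K} (h : Generic q t) (m : ℤ) :
    1 - t ^ 2 * q ^ m ≠ 0 := by
  rw [mul_comm]
  exact_mod_cast h.one_sub_ne_zero (n := 2) (Or.inr (by norm_num))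

theorem phiCoeff_eq (q t : K) {i j k : Fin 3} (hij : i ≠ j) (hki : k ≠ i) (hkj : k ≠ j)
    (l m : Triple) :
    phiCoeff q t l m = (q ^ 2 / t) ^ (m i + m j + m k)
      * (qPoch (q ^ 2 * t ^ 2) (q ^ 2) (m i + m j + m k - (l i + l j + l k)))⁻¹
      * (pochPair q t (l j + l k) (m i) * pochPair q t (l i + l k) (m j)
        * pochPair q t (l i + l j) (m k)) := by
  rw [phiCoeff, total, total, sum_distinct hij hki hkj, sum_distinct hij hki hkj,
    prod_distinct hij hki hkj, unprime_eq hij hki hkj, unprime_eq hij.symm hkj hki,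
    unprime_eq hki hkj.symm hij.symm, div_eq_mul_inv]

/-- Both sides are the coefficient of one `gPoly`, at the index `gIdx (l + Pi.single k 1) m`, in x +
1/x times `phiExt`. The condition `hm` leaves out the indices where `gPoly_of_neg` makes this
polynomial zero. -/
theorem phiCoeff_pieri {q t : K} (hqt : Generic q t) {i j k : Fin 3} (hij : i ≠ j) (hki : k ≠ i)
    (hkj : k ≠ j) {l : Triple} (hl : ∀ a, 0 ≤ unprime l a) {m : Triple}
    (hm : ∀ a, 0 ≤ unprime (gIdx (l + Pi.single k 1) m) a) :
    phiCoeff q t l (m - Pi.single i 1 - Pi.single j 1)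
          * (1 - q ^ (2 * (gIdx l (m - Pi.single i 1 - Pi.single j 1) k + 1)))
        + phiCoeff q t l (m - Pi.single i 1 - Pi.single j 1 + Pi.single k 1)
          * (t * q ^ (2 * (gIdx l (m - Pi.single i 1 - Pi.single j 1 + Pi.single k 1) k + 1)))
        - phiCoeff q t l (m - Pi.single i 1)
          * (t * q ^ (2 * (gIdx l (m - Pi.single i 1) j + gIdx l (m - Pi.single i 1) k + 1)))
        - phiCoeff q t l (m - Pi.single j 1)
          * (t * q ^ (2 * (gIdx l (m - Pi.single j 1) i + gIdx l (m - Pi.single j 1) k + 1)))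
        + phiCoeff q t l m * (1 - t ^ 2 * q ^ (2 * total (gIdx l m)))
      = pieriCoeff q t (unprime l) i j k 1 1 * phiCoeff q t (l + Pi.single k 1) m
        + pieriCoeff q t (unprime l) i j k 1 (-1)
          * phiCoeff q t (l - Pi.single i 1 + Pi.single j 1) (m - Pi.single j 1)
        + pieriCoeff q t (unprime l) i j k (-1) 1
          * phiCoeff q t (l + Pi.single i 1 - Pi.single j 1) (m - Pi.single i 1)
        + pieriCoeff q t (unprime l) i j k (-1) (-1)
          * phiCoeff q t (l - Pi.single k 1) (m - Pi.single i 1 - Pi.single j 1) := by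
  have hq := hqt.q_ne_zero
  have ht := hqt.t_ne_zero
  have hκ : q ^ 2 / t ≠ 0 := div_ne_zero (pow_ne_zero 2 hq) ht
  have ua := unprime_eq hij hki hkj l
  have ub := unprime_eq hij.symm hkj hki l
  have uc := unprime_eq hki hkj.symm hij.symm l
  have ha := hl i
  have hb := hl j
  have hc := hl k
  have hu := hm i
  have hv := hm j
  have hw := hm k
  rw [unprime_gIdx, unprime_eq hij hki hkj] at hu
  rw [unprime_gIdx, unprime_eq hij.symm hkj hki] at hv
  rw [unprime_gIdx, unprime_eq hki hkj.symm hij.symm] at hw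
  rw [ua] at ha
  rw [ub] at hb
  rw [uc] at hc
  simp only [pieriCoeff, prime_unprime, total_unprime, ua, ub, uc]
  simp only [phiCoeff_eq q t hij hki hkj, gIdx, total, sum_distinct hij hki hkj, Pi.add_apply,
    Pi.sub_apply, Pi.single_eq_same, Pi.single_eq_of_ne hij, Pi.single_eq_of_ne hij.symm,
    Pi.single_eq_of_ne hki, Pi.single_eq_of_ne hki.symm, Pi.single_eq_of_ne hkj,
    Pi.single_eq_of_ne hkj.symm, add_zero, sub_zero, if_true] at hu hv hw ⊢
  simp only [show ¬ (-1 : ℤ) = 1 by norm_num, if_false]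
  -- All symbols are reduced to the lowest point (u, v, w) = m - δ^i - δ^j. Its entries are
  -- nonnegative: `hm` gives 2 m_i > l_j + l_k and 2 m_j > l_i + l_k.
  obtain ⟨u, hmu⟩ : ∃ u, m i = u + 1 := ⟨m i - 1, by ring⟩
  obtain ⟨v, hmv⟩ : ∃ v, m j = v + 1 := ⟨m j - 1, by ring⟩
  generalize m i = mi at *
  generalize m j = mj at *
  generalize m k = w at *
  subst hmu hmv
  generalize l i = l₁ at *
  generalize l j = l₂ at *
  generalize l k = l₃ at *
  clear hm hl ua ub uc
  have u0 : 0 ≤ u := by omega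
  have v0 : 0 ≤ v := by omega
  have w0 : 0 ≤ w := by omega
  have zadd : ∀ a b : ℤ, q ^ (2 * (a + b)) = q ^ (2 * a) * q ^ (2 * b) := fun a b => by
    rw [mul_add, zpow_add₀ hq]
  have zsub : ∀ a b : ℤ, q ^ (2 * (a - b)) = q ^ (2 * a) / q ^ (2 * b) := fun a b => by
    rw [mul_sub, zpow_sub₀ hq]
  have zadd2 : ∀ a : ℤ, q ^ (2 * a + 2) = q ^ (2 * a) * q ^ 2 := fun a => by
    rw [zpow_add₀ hq]; norm_cast
  have zsub2 : ∀ a : ℤ, q ^ (2 * a - 2) = q ^ (2 * a) / q ^ 2 := fun a => by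
    rw [zpow_sub₀ hq]; norm_cast
  have zmul2 : ∀ a : ℤ, q ^ (2 * (2 * a)) = (q ^ (2 * a)) ^ 2 := fun a => by
    rw [two_mul (2 * a), zpow_add₀ hq, sq]
  have zone : q ^ (2 * 1 : ℤ) = q ^ 2 := by norm_cast
  have ztwo : q ^ (2 * 2 : ℤ) = (q ^ 2) ^ 2 := by rw [← pow_mul]; norm_cast
  have zneg : ∀ a : ℤ, q ^ (-2 * a) = (q ^ (2 * a))⁻¹ := fun a => by rw [neg_mul, zpow_neg]
  have tneg : t ^ (-2 : ℤ) = (t ^ 2)⁻¹ := by rw [zpow_neg]; norm_cast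
  simp only [add_sub_cancel_right,
    show u + v + (w + 1) - (l₁ + l₂ + l₃) = u + v + w - (l₁ + l₂ + l₃) + 1 by ring,
    show u + (v + 1) + w - (l₁ + l₂ + l₃) = u + v + w - (l₁ + l₂ + l₃) + 1 by ring,
    show u + 1 + v + w - (l₁ + l₂ + l₃) = u + v + w - (l₁ + l₂ + l₃) + 1 by ring,
    show u + 1 + (v + 1) + w - (l₁ + l₂ + l₃) = u + v + w - (l₁ + l₂ + l₃) + 1 + 1 by ring,
    show u + 1 + (v + 1) + w - (l₁ + l₂ + (l₃ + 1)) = u + v + w - (l₁ + l₂ + l₃) + 1 by ring,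
    show u + 1 + v + w - (l₁ - 1 + (l₂ + 1) + l₃) = u + v + w - (l₁ + l₂ + l₃) + 1 by ring,
    show u + (v + 1) + w - (l₁ + 1 + (l₂ - 1) + l₃) = u + v + w - (l₁ + l₂ + l₃) + 1 by ring,
    show u + v + w - (l₁ + l₂ + (l₃ - 1)) = u + v + w - (l₁ + l₂ + l₃) + 1 by ring,
    show l₂ + (l₃ + 1) = l₂ + l₃ + 1 by ring, show l₁ + (l₃ + 1) = l₁ + l₃ + 1 by ring,
    show l₂ + 1 + l₃ = l₂ + l₃ + 1 by ring, show l₁ + 1 + l₃ = l₁ + l₃ + 1 by ring,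
    show l₂ + (l₃ - 1) = l₂ + l₃ - 1 by ring, show l₁ + (l₃ - 1) = l₁ + l₃ - 1 by ring,
    show l₂ - 1 + l₃ = l₂ + l₃ - 1 by ring, show l₁ - 1 + l₃ = l₁ + l₃ - 1 by ring,
    show l₁ - 1 + (l₂ + 1) = l₁ + l₂ by ring, show l₁ + 1 + (l₂ - 1) = l₁ + l₂ by ring,
    pochPair_up hq t _ u0, pochPair_up hq t _ v0, pochPair_succ q t _ u0, pochPair_succ q t _ v0,
    pochPair_succ q t _ w0]
  have hd₁ := pochPair_down hq t (l₂ + l₃) u0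
  have hd₂ := pochPair_down hq t (l₁ + l₃) v0
  have hT : 0 ≤ u + v + w - (l₁ + l₂ + l₃) + 1 := by omega
  -- The length u + v + w - |l| can be -1, where `qPoch` has the default value 1 and its recursion
  -- fails. Then the inequalities in `hm` are equalities, and the factor 1 - q^{...} on both sides
  -- is 1 - q^0 = 0.
  have hP₁ : (qPoch (q ^ 2 * t ^ 2) (q ^ 2) (u + v + w - (l₁ + l₂ + l₃)))⁻¹
        * (1 - q ^ (2 * (u + v + w - 2 * w - l₃ + 1)))
      = (qPoch (q ^ 2 * t ^ 2) (q ^ 2) (u + v + w - (l₁ + l₂ + l₃) + 1))⁻¹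
        * ((1 - q ^ (2 * (u + v + w - 2 * w - l₃ + 1)))
          * (1 - t ^ 2 * q ^ (2 * (u + v + w - (l₁ + l₂ + l₃) + 1)))) := by
    rcases hT.eq_or_lt with h | h
    · rw [show u + v + w - 2 * w - l₃ + 1 = 0 by omega]
      simp
    · have := hqt.one_sub_sq_mul_ne_zero (2 * (u + v + w - (l₁ + l₂ + l₃) + 1))
      rw [qPoch_succ _ _ (by omega), show (q ^ 2) ^ (u + v + w - (l₁ + l₂ + l₃)) * (q ^ 2 * t ^ 2)
        = t ^ 2 * q ^ (2 * (u + v + w - (l₁ + l₂ + l₃) + 1)) by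
          rw [q_sq_zpow, zadd (u + v + w - (l₁ + l₂ + l₃)), zone]; ring, mul_inv]
      field_simp
  have hP₂ : (qPoch (q ^ 2 * t ^ 2) (q ^ 2) (u + v + w - (l₁ + l₂ + l₃) + 1 + 1))⁻¹
        * (1 - t ^ 2 * q ^ (2 * (u + v + w - (l₁ + l₂ + l₃) + 2)))
      = (qPoch (q ^ 2 * t ^ 2) (q ^ 2) (u + v + w - (l₁ + l₂ + l₃) + 1))⁻¹ := by
    have := hqt.one_sub_sq_mul_ne_zero (2 * (u + v + w - (l₁ + l₂ + l₃) + 2))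
    rw [qPoch_succ _ _ hT, show (q ^ 2) ^ (u + v + w - (l₁ + l₂ + l₃) + 1) * (q ^ 2 * t ^ 2)
      = t ^ 2 * q ^ (2 * (u + v + w - (l₁ + l₂ + l₃) + 2)) by
        rw [q_sq_zpow, zadd _ 1, zadd _ 2, zone, ztwo]; ring, mul_inv]
    field_simp
  have n₁ := hqt.one_sub_zpow_ne_zero (m := 2 * (l₂ + l₃ + 1)) (by omega)
  have n₂ := hqt.one_sub_zpow_ne_zero (m := 2 * (l₁ + l₃ + 1)) (by omega)
  have n₃ := hqt.one_sub_sq_mul_ne_zero (2 * (l₂ + l₃))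
  have n₄ := hqt.one_sub_sq_mul_ne_zero (2 * (l₁ + l₃))
  have key := phiExt_pieri_rational (Q := q ^ 2) (t := t) (L₁ := q ^ (2 * l₁))
    (L₂ := q ^ (2 * l₂)) (L₃ := q ^ (2 * l₃)) (x := q ^ (2 * u)) (y := q ^ (2 * v))
    (z := q ^ (2 * w)) (pow_ne_zero 2 hq) ht (zpow_ne_zero _ hq) (zpow_ne_zero _ hq)
    (zpow_ne_zero _ hq) (zpow_ne_zero _ hq)
    (by rwa [zadd, zadd, zone, mul_comm (_ * _)] at n₁)
    (by rwa [zadd, zadd, zone, mul_comm (_ * _)] at n₂) (by rwa [zadd] at n₃)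
    (by rwa [zadd] at n₄)
  have zx := zpow_ne_zero (2 * u) hq
  have zy := zpow_ne_zero (2 * v) hq
  have zw := zpow_ne_zero (2 * w) hq
  have zl₁ := zpow_ne_zero (2 * l₁) hq
  have zl₂ := zpow_ne_zero (2 * l₂) hq
  have zl₃ := zpow_ne_zero (2 * l₃) hq
  simp only [zadd, zsub, zadd2, zsub2, zmul2, zone, ztwo, zneg, tneg, zpow_add₀ hκ, zpow_one]
    at hd₁ hd₂ hP₁ hP₂ ⊢
  generalize pochPair q t (l₂ + l₃ - 1) u = d₁ at *
  generalize pochPair q t (l₁ + l₃ - 1) v = d₂ at *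
  generalize pochPair q t (l₂ + l₃) u = A₁ at *
  generalize pochPair q t (l₁ + l₃) v = A₂ at *
  generalize pochPair q t (l₁ + l₂) w = A₃ at *
  generalize (qPoch (q ^ 2 * t ^ 2) (q ^ 2) (u + v + w - (l₁ + l₂ + l₃)))⁻¹ = P₀ at *
  generalize (qPoch (q ^ 2 * t ^ 2) (q ^ 2) (u + v + w - (l₁ + l₂ + l₃) + 1))⁻¹ = P₁ at *
  generalize (qPoch (q ^ 2 * t ^ 2) (q ^ 2) (u + v + w - (l₁ + l₂ + l₃) + 1 + 1))⁻¹ = P₂ at *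
  generalize (q ^ 2 / t) ^ u = k₁ at *
  generalize (q ^ 2 / t) ^ v = k₂ at *
  generalize (q ^ 2 / t) ^ w = k₃ at *
  generalize q ^ (2 * l₁) = L₁ at *
  generalize q ^ (2 * l₂) = L₂ at *
  generalize q ^ (2 * l₃) = L₃ at *
  generalize q ^ (2 * u) = x at *
  generalize q ^ (2 * v) = y at *
  generalize q ^ (2 * w) = z at *
  have hQ : q ^ 2 ≠ 0 := pow_ne_zero 2 hq
  generalize q ^ 2 = Q at *
  clear hκ zadd zsub zadd2 zsub2 zmul2 zone ztwo zneg tneg n₁ n₂ n₃ n₄ hqt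
  have f₁ : x * y * z / z ^ 2 / L₃ * Q = Q * x * y / (z * L₃) := by field_simp
  have f₂ : x * y * (z * Q) / (z * Q) ^ 2 / L₃ * Q = x * y / (z * L₃) := by field_simp
  have f₃ : x * (y * Q) * z / (y * Q) ^ 2 / L₂ * (x * (y * Q) * z / z ^ 2 / L₃) * Q
      = Q * x ^ 2 / (L₂ * L₃) := by field_simp
  have f₄ : x * Q * y * z / (x * Q) ^ 2 / L₁ * (x * Q * y * z / z ^ 2 / L₃) * Q
      = Q * y ^ 2 / (L₁ * L₃) := by field_simp
  have f₅ : x * Q * (y * Q) * z / (x * Q) ^ 2 / L₁ * (x * Q * (y * Q) * z / (y * Q) ^ 2 / L₂)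
      * (x * Q * (y * Q) * z / z ^ 2 / L₃) = x * y * z / (L₁ * L₂ * L₃) * Q ^ 2 := by field_simp
  rw [f₁] at hP₁
  rw [f₁, f₂, f₃, f₄, f₅]
  -- `key` is multiplied by the common factor; `hP₁` and `hP₂` adjust the denominator symbol, and
  -- `hd₁`, `hd₂` eliminate the lowered pairs, one factor at a time in their product.
  linear_combination (k₁ * k₂ * k₃ * P₁ * (A₁ * A₂ * A₃)) * key
    + (k₁ * k₂ * k₃ * (A₁ * A₂ * A₃)) * hP₁
    + (k₁ * (Q / t) * (k₂ * (Q / t)) * k₃ * (A₁ * ((1 - x * t ^ 2) * (1 - x * (L₂ * L₃)⁻¹))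
      * (A₂ * ((1 - y * t ^ 2) * (1 - y * (L₁ * L₃)⁻¹))) * A₃)) * hP₂
    - (t * (L₂ * L₃ / L₁ * Q) * ((1 - t ^ 2 * (L₁ / Q)) * (1 - L₂ * Q)) / (1 - L₂ * L₃ * Q)
        / ((1 - t ^ 2 * (L₂ * L₃)) * (1 - t ^ 2 * (L₁ * L₃)))
        * (k₁ * (Q / t) * k₂ * k₃ * P₁ * (A₁ * ((1 - x * t ^ 2) * (1 - (L₂ * L₃ * Q)⁻¹)) * A₃))
      + (t ^ 2)⁻¹ * (Q ^ 2 / (L₂ * L₃) / (L₁ * L₃))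
        * ((1 - t ^ 4 * (L₁ * L₂ * L₃ / Q)) * (1 - t ^ 2 * (L₃ / Q)))
        / ((1 - t ^ 2 * (L₂ * L₃)) * (1 - t ^ 2 * (L₁ * L₃))) * (k₁ * k₂ * k₃ * P₁ * A₃)
        * (A₁ * (-(L₂ * L₃) * (1 - x * (L₂ * L₃)⁻¹)))) * hd₂
    - (t * (L₁ * L₃ / L₂ * Q) * ((1 - t ^ 2 * (L₂ / Q)) * (1 - L₁ * Q)) / (1 - L₁ * L₃ * Q)
        / ((1 - t ^ 2 * (L₂ * L₃)) * (1 - t ^ 2 * (L₁ * L₃)))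
        * (k₁ * (k₂ * (Q / t)) * k₃ * P₁ * (A₂ * ((1 - y * t ^ 2) * (1 - (L₁ * L₃ * Q)⁻¹)) * A₃))
      + (t ^ 2)⁻¹ * (Q ^ 2 / (L₂ * L₃) / (L₁ * L₃))
        * ((1 - t ^ 4 * (L₁ * L₂ * L₃ / Q)) * (1 - t ^ 2 * (L₃ / Q)))
        / ((1 - t ^ 2 * (L₂ * L₃)) * (1 - t ^ 2 * (L₁ * L₃))) * (k₁ * k₂ * k₃ * P₁ * A₃)
        * (d₂ * (1 - L₁ * L₃))) * hd₁

theorem phiCoeff_shift_finite {q : K} (hq : q ≠ 0) (t : K) {l : Triple}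
    (hl : ∀ a, 0 ≤ unprime l a) (c : Triple → K) (l' v : Triple) (hl' : ∀ a, 0 ≤ unprime l' a) :
    Function.HasFiniteSupport
      fun m => (phiCoeff q t l (m - v) * c (m - v)) • gPoly q t (gIdx l' m) := by
  have h := phiCoeff_smul_finite hq t hl c (fun m => gIdx l' (m + v)) (2 * ∑ a, |v a|)
    fun m a => by
      have h1 := single_le_sum (f := fun a => |v a|) (fun b _ => abs_nonneg (v b)) (mem_univ a)
      have h2 := le_abs_self (v a)
      have h3 := hl' a
      simp only [unprime_gIdx, Pi.add_apply] at h1 ⊢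
      omega
  have h' := h.preimage (Equiv.subRight v).injective.injOn
  refine h'.subset fun m hm => ?_
  simpa using hm

theorem phiCoeff_finite_of_shift {q : K} (hq : q ≠ 0) (t : K) {l : Triple}
    (hl : ∀ a, 0 ≤ unprime l a) (c : Triple → K) (l' v : Triple) (hl' : ∀ a, 0 ≤ unprime l' a)
    (g : Triple → Triple) (hg : ∀ m, g m = gIdx l' (m + v)) :
    Function.HasFiniteSupport fun m => (phiCoeff q t l m * c m) • gPoly q t (g m) := by
  have h := (phiCoeff_shift_finite hq t hl c l' v hl').fun_comp_of_injective
    (Equiv.addRight v).injective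
  simpa [hg] using h

/-- Translation of m brings every sum in the Pieri rule to the same family `gPoly q t (gIdx l' m)`,
so that it suffices to compare coefficients. -/
theorem phiCoeff_finsum_shift (q t : K) (l : Triple) (c : Triple → K) (l' v : Triple)
    (g : Triple → Triple) (hg : ∀ m, g m = gIdx l' (m + v)) :
    ∑ᶠ m, (phiCoeff q t l m * c m) • gPoly q t (g m)
      = ∑ᶠ m, (phiCoeff q t l (m - v) * c (m - v)) • gPoly q t (gIdx l' m) := by
  rw [← finsum_comp_equiv (Equiv.subRight v)]
  refine finsum_congr fun m => ?_
  simp [hg]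

theorem phiExt_eq_shift (q t : K) (c : K) (l l' v : Triple)
    (hg : ∀ m, gIdx l m = gIdx l' (m + v)) :
    c • phiExt q t l = ∑ᶠ m, (phiCoeff q t l (m - v) * c) • gPoly q t (gIdx l' m) := by
  rw [← phiCoeff_finsum_shift q t l (fun _ => c) l' v _ hg, phiExt, smul_finsum]
  exact finsum_congr fun m => by rw [smul_smul, mul_comm]

theorem pieriCoeff_eq_zero_left (q t : K) {l : Triple} {i : Fin 3} (j k : Fin 3) (h : l i = 0)
    (b : ℤ) : pieriCoeff q t l i j k (-1) b = 0 := by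
  simp [pieriCoeff, h]

theorem pieriCoeff_eq_zero_right (q t : K) {l : Triple} {j : Fin 3} (i k : Fin 3) (h : l j = 0)
    (a : ℤ) : pieriCoeff q t l i j k a (-1) = 0 := by
  simp [pieriCoeff, h]

theorem finsum_combination₄ {ι M : Type*} [AddCommGroup M] {f₁ f₂ f₃ f₄ : ι → M}
    (h₁ : Function.HasFiniteSupport f₁) (h₂ : Function.HasFiniteSupport f₂)
    (h₃ : Function.HasFiniteSupport f₃) (h₄ : Function.HasFiniteSupport f₄) :
    ∑ᶠ m, f₁ m + ∑ᶠ m, f₂ m + ∑ᶠ m, f₃ m + ∑ᶠ m, f₄ m = ∑ᶠ m, (f₁ m + f₂ m + f₃ m + f₄ m) := by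
  rw [finsum_add_distrib (by fun_prop) h₄, finsum_add_distrib (by fun_prop) h₃,
    finsum_add_distrib h₁ h₂]

theorem finsum_combination₅ {ι M : Type*} [AddCommGroup M] {f₁ f₂ f₃ f₄ f₅ : ι → M}
    (h₁ : Function.HasFiniteSupport f₁) (h₂ : Function.HasFiniteSupport f₂)
    (h₃ : Function.HasFiniteSupport f₃) (h₄ : Function.HasFiniteSupport f₄)
    (h₅ : Function.HasFiniteSupport f₅) :
    ∑ᶠ m, f₁ m + ∑ᶠ m, f₂ m - ∑ᶠ m, f₃ m - ∑ᶠ m, f₄ m + ∑ᶠ m, f₅ m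
      = ∑ᶠ m, (f₁ m + f₂ m - f₃ m - f₄ m + f₅ m) := by
  rw [finsum_add_distrib (by fun_prop) h₅, finsum_sub_distrib (by fun_prop) h₄,
    finsum_sub_distrib (by fun_prop) h₃, finsum_add_distrib h₁ h₂]

set_option maxHeartbeats 800000 in
-- Entries of `l` may be negative, that is, triangle inequalities may fail; the propagation of zeros
-- in `phiExt_eq_zero_of_base` relies on this.
theorem xPlusInv_mul_phiExt {q t : K} (hqt : Generic q t) {i j k : Fin 3} (hij : i ≠ j)
    (hki : k ≠ i) (hkj : k ≠ j) {l : Triple} (hl : ∀ a, 0 ≤ unprime l a) :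
    xPlusInv K k * phiExt q t l
      = pieriCoeff q t (unprime l) i j k 1 1 • phiExt q t (l + Pi.single k 1)
        + pieriCoeff q t (unprime l) i j k 1 (-1)
          • phiExt q t (l - Pi.single i 1 + Pi.single j 1)
        + pieriCoeff q t (unprime l) i j k (-1) 1
          • phiExt q t (l + Pi.single i 1 - Pi.single j 1)
        + pieriCoeff q t (unprime l) i j k (-1) (-1) • phiExt q t (l - Pi.single k 1) := by
  have hq := hqt.q_ne_zero
  have ua := unprime_eq hij hki hkj
  have ub := unprime_eq hij.symm hkj hki
  have uc := unprime_eq hki hkj.symm hij.symm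
  have ha := hl i
  have hb := hl j
  have hc := hl k
  have tot : ∀ m : Triple, total m = m i + m j + m k := sum_distinct hij hki hkj
  have ofall : ∀ v : Triple, 0 ≤ v i → 0 ≤ v j → 0 ≤ v k → ∀ a, 0 ≤ v a := by
    intro v h1 h2 h3 a
    rcases eq_or_of_distinct hij hki hkj a with rfl | rfl | rfl <;> assumption
  have hγ : ∀ a, 0 ≤ unprime (l + Pi.single k 1) a := by
    rw [ua] at ha
    rw [ub] at hb
    rw [uc] at hc
    refine ofall _ ?_ ?_ ?_ <;>
      simp [ua, ub, uc, hij, hij.symm, hki, hki.symm, hkj, hkj.symm] <;> omega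
  have hX : ∀ m, phiCoeff q t l m • (xPlusInv K k * gPoly q t (gIdx l m))
      = (phiCoeff q t l m * (1 - q ^ (2 * (gIdx l m k + 1))))
          • gPoly q t (gIdx l m + Pi.single k 1)
        + (phiCoeff q t l m * (t * q ^ (2 * (gIdx l m k + 1))))
          • gPoly q t (gIdx l m + Pi.single k 3 - 1)
        - (phiCoeff q t l m * (t * q ^ (2 * (gIdx l m j + gIdx l m k + 1))))
          • gPoly q t (gIdx l m - Pi.single i 1 + Pi.single j 1)
        - (phiCoeff q t l m * (t * q ^ (2 * (gIdx l m i + gIdx l m k + 1))))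
          • gPoly q t (gIdx l m + Pi.single i 1 - Pi.single j 1)
        + (phiCoeff q t l m * (1 - t ^ 2 * q ^ (2 * total (gIdx l m))))
          • gPoly q t (gIdx l m - Pi.single k 1) := by
    intro m
    rw [xPlusInv_mul_gPoly hqt _ hij hki hkj]
    simp only [smul_add, smul_sub, smul_smul]
  have pi : ∀ c : ℤ, (Pi.single i c : Triple) j = 0 ∧ (Pi.single i c : Triple) k = 0 := fun c => by
    simp [hij.symm, hki]
  have pj : ∀ c : ℤ, (Pi.single j c : Triple) i = 0 ∧ (Pi.single j c : Triple) k = 0 := fun c => by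
    simp [hij, hkj]
  have pk : ∀ c : ℤ, (Pi.single k c : Triple) i = 0 ∧ (Pi.single k c : Triple) j = 0 := fun c => by
    simp [hki.symm, hkj.symm]
  have g₁ : ∀ m, gIdx l m + Pi.single k 1
      = gIdx (l + Pi.single k 1) (m + (Pi.single i 1 + Pi.single j 1)) := fun m => by
    refine triple_ext hij hki hkj ?_ ?_ ?_ <;> simp [gIdx, tot, pi, pj, pk] <;> ring
  have g₂ : ∀ m, gIdx l m + Pi.single k 3 - 1
      = gIdx (l + Pi.single k 1) (m + (Pi.single i 1 + Pi.single j 1 - Pi.single k 1)) := fun m => by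
    refine triple_ext hij hki hkj ?_ ?_ ?_ <;> simp [gIdx, tot, pi, pj, pk] <;> ring
  have g₃ : ∀ m, gIdx l m - Pi.single i 1 + Pi.single j 1
      = gIdx (l + Pi.single k 1) (m + Pi.single i 1) := fun m => by
    refine triple_ext hij hki hkj ?_ ?_ ?_ <;> simp [gIdx, tot, pi, pj, pk] <;> ring
  have g₄ : ∀ m, gIdx l m + Pi.single i 1 - Pi.single j 1
      = gIdx (l + Pi.single k 1) (m + Pi.single j 1) := fun m => by
    refine triple_ext hij hki hkj ?_ ?_ ?_ <;> simp [gIdx, tot, pi, pj, pk] <;> ring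
  have g₅ : ∀ m, gIdx l m - Pi.single k 1 = gIdx (l + Pi.single k 1) (m + 0) := fun m => by
    refine triple_ext hij hki hkj ?_ ?_ ?_ <;> simp [gIdx, tot, pi, pj, pk] <;> ring
  have r₁ : ∀ m, gIdx (l + Pi.single k 1) m = gIdx (l + Pi.single k 1) (m + 0) := fun m => by
    rw [add_zero]
  have r₂ : ∀ m, gIdx (l - Pi.single i 1 + Pi.single j 1) m
      = gIdx (l + Pi.single k 1) (m + Pi.single j 1) := fun m => by
    refine triple_ext hij hki hkj ?_ ?_ ?_ <;> simp [gIdx, tot, pi, pj, pk] <;> ring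
  have r₃ : ∀ m, gIdx (l + Pi.single i 1 - Pi.single j 1) m
      = gIdx (l + Pi.single k 1) (m + Pi.single i 1) := fun m => by
    refine triple_ext hij hki hkj ?_ ?_ ?_ <;> simp [gIdx, tot, pi, pj, pk] <;> ring
  have r₄ : ∀ m, gIdx (l - Pi.single k 1) m
      = gIdx (l + Pi.single k 1) (m + (Pi.single i 1 + Pi.single j 1)) := fun m => by
    refine triple_ext hij hki hkj ?_ ?_ ?_ <;> simp [gIdx, tot, pi, pj, pk] <;> ring
  have fin := fun c v g hg => phiCoeff_finite_of_shift hq t hl c _ v hγ g hg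
  have f₁ := fin (fun m => 1 - q ^ (2 * (gIdx l m k + 1))) _ _ g₁
  have f₂ := fin (fun m => t * q ^ (2 * (gIdx l m k + 1))) _ _ g₂
  have f₃ := fin (fun m => t * q ^ (2 * (gIdx l m j + gIdx l m k + 1))) _ _ g₃
  have f₄ := fin (fun m => t * q ^ (2 * (gIdx l m i + gIdx l m k + 1))) _ _ g₄
  have f₅ := fin (fun m => 1 - t ^ 2 * q ^ (2 * total (gIdx l m))) _ _ g₅
  have fin' := fun c v => phiCoeff_shift_finite hq t hl c _ v hγ
  have s₁ := fin' (fun m => 1 - q ^ (2 * (gIdx l m k + 1))) (Pi.single i 1 + Pi.single j 1)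
  have s₂ := fin' (fun m => t * q ^ (2 * (gIdx l m k + 1)))
    (Pi.single i 1 + Pi.single j 1 - Pi.single k 1)
  have s₃ := fin' (fun m => t * q ^ (2 * (gIdx l m j + gIdx l m k + 1))) (Pi.single i 1)
  have s₄ := fin' (fun m => t * q ^ (2 * (gIdx l m i + gIdx l m k + 1))) (Pi.single j 1)
  have s₅ := fin' (fun m => 1 - t ^ 2 * q ^ (2 * total (gIdx l m))) 0
  -- A shift can make an entry of `unprime` negative, where the cut-off of the sum is lost. The
  -- Pieri coefficient is then 0, hence the alternative c = 0.
  have finr : ∀ (l' v : Triple) (c : K), c = 0 ∨ (∀ a, 0 ≤ unprime l' a) →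
      Function.HasFiniteSupport fun m =>
        (phiCoeff q t l' (m - v) * c) • gPoly q t (gIdx (l + Pi.single k 1) m) := by
    rintro l' v c (rfl | h)
    · simp [Function.HasFiniteSupport]
    · exact phiCoeff_shift_finite hq t h (fun _ => c) _ v hγ
  have t₁ := finr (l + Pi.single k 1) 0 (pieriCoeff q t (unprime l) i j k 1 1) (Or.inr hγ)
  have t₂ := finr (l - Pi.single i 1 + Pi.single j 1) (Pi.single j 1)
    (pieriCoeff q t (unprime l) i j k 1 (-1)) (by
      rcases hb.eq_or_lt with h | h
      · exact Or.inl (pieriCoeff_eq_zero_right q t i k h.symm 1)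
      · right
        rw [ua] at ha
        rw [ub] at h
        rw [uc] at hc
        refine ofall _ ?_ ?_ ?_ <;> simp [ua, ub, uc, pi, pj, pk] <;> omega)
  have t₃ := finr (l + Pi.single i 1 - Pi.single j 1) (Pi.single i 1)
    (pieriCoeff q t (unprime l) i j k (-1) 1) (by
      rcases ha.eq_or_lt with h | h
      · exact Or.inl (pieriCoeff_eq_zero_left q t j k h.symm 1)
      · right
        rw [ua] at h
        rw [ub] at hb
        rw [uc] at hc
        refine ofall _ ?_ ?_ ?_ <;> simp [ua, ub, uc, pi, pj, pk] <;> omega)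
  have t₄ := finr (l - Pi.single k 1) (Pi.single i 1 + Pi.single j 1)
    (pieriCoeff q t (unprime l) i j k (-1) (-1)) (by
      rcases ha.eq_or_lt with h | h
      · exact Or.inl (pieriCoeff_eq_zero_left q t j k h.symm _)
      rcases hb.eq_or_lt with h' | h'
      · exact Or.inl (pieriCoeff_eq_zero_right q t i k h'.symm _)
      · right
        rw [ua] at h
        rw [ub] at h'
        rw [uc] at hc
        refine ofall _ ?_ ?_ ?_ <;> simp [ua, ub, uc, pi, pj, pk] <;> omega)
  rw [phiExt_eq_shift q t _ _ _ _ r₁, phiExt_eq_shift q t _ _ _ _ r₂,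
    phiExt_eq_shift q t _ _ _ _ r₃, phiExt_eq_shift q t _ _ _ _ r₄, phiExt, mul_finsum]
  simp only [mul_smul_comm, hX]
  rw [← finsum_combination₅ f₁ f₂ f₃ f₄ f₅]
  rw [phiCoeff_finsum_shift q t l (fun m => 1 - q ^ (2 * (gIdx l m k + 1))) _ _ _ g₁,
    phiCoeff_finsum_shift q t l (fun m => t * q ^ (2 * (gIdx l m k + 1))) _ _ _ g₂,
    phiCoeff_finsum_shift q t l (fun m => t * q ^ (2 * (gIdx l m j + gIdx l m k + 1))) _ _ _ g₃,
    phiCoeff_finsum_shift q t l (fun m => t * q ^ (2 * (gIdx l m i + gIdx l m k + 1))) _ _ _ g₄,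
    phiCoeff_finsum_shift q t l (fun m => 1 - t ^ 2 * q ^ (2 * total (gIdx l m))) _ _ _ g₅]
  rw [finsum_combination₅ s₁ s₂ s₃ s₄ s₅, finsum_combination₄ t₁ t₂ t₃ t₄]
  refine finsum_congr fun m => ?_
  by_cases hm : ∀ a, 0 ≤ unprime (gIdx (l + Pi.single k 1) m) a
  · have key := phiCoeff_pieri hqt hij hki hkj hl hm
    simp only [← add_smul, ← sub_smul, sub_zero,
      show m - (Pi.single i 1 + Pi.single j 1 - Pi.single k 1)
        = m - Pi.single i 1 - Pi.single j 1 + Pi.single k 1 by abel,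
      show m - (Pi.single i 1 + Pi.single j 1) = m - Pi.single i 1 - Pi.single j 1 by abel]
    congr 1
    linear_combination key
  · push Not at hm
    obtain ⟨a, ha⟩ := hm
    simp [gPoly_of_neg q t ha]

/-! ### Vanishing of `phiExt` outside the triangle inequalities -/

theorem hermite_zero (p : K) (a : Fin 3) : hermite p a 0 = 1 := by
  rw [hermite_eq_sum, Icc_self, sum_singleton]
  simp [hermiteTerm, invPoch, qPoch_zero, AddMonoidAlgebra.one_def]

/-- Nonnegativity of the degrees leaves only p = e δ^i, s = 0: the pairs with ν_i + ν_j = ν_i + ν_k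
= 0 force p_k = p_j = s = 0, and then h_i and h_j + h_k bound p_i by e from both sides. All degrees
are then 0. -/
theorem gPoly_axis {q : K} (t : K) {i j k : Fin 3} (hij : i ≠ j)
    (hki : k ≠ i) (hkj : k ≠ j) {ν : Triple} {e : ℤ} (hi : ν i = -e) (hj : ν j = e)
    (hk : ν k = e) : gPoly q t ν = (t ^ e * invPoch (q ^ 2) e) • (1 : Laurent K) := by
  have hidx : hermiteIdx ν (Pi.single i e, 0) = 0 := by
    refine triple_ext hij hki hkj ?_ ?_ ?_ <;>
      simp [hermiteIdx, total, sum_distinct hij hki hkj, hi, hj, hk, hij, hki, hkj, hij.symm,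
        hki.symm, hkj.symm] <;> ring
  rw [gPoly, moment, finsum_eq_single _ (Pi.single i e, 0)]
  · rw [momentTerm, hidx]
    congr 1
    · have h0 : ∀ x : Triple, dot x 0 = 0 ∧ dot 0 x = 0 := fun x => by simp [dot]
      simp [weight, h0, total, normSq, sum_distinct hij hki hkj, prod_distinct hij hki hkj, hij,
        hki, hkj, hij.symm, hki.symm, hkj.symm, invPoch_of_nonneg _ le_rfl, qPoch_zero]
    · simp [hermiteProd, hermite_zero]
  · intro x hx
    by_contra h
    obtain ⟨hp, hs, hh⟩ := momentTerm_support q t ν 0 0 h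
    apply hx
    have := hp i
    have := hp j
    have := hp k
    have h1 := hh i
    have h2 := hh j
    have h3 := hh k
    simp only [hermiteIdx, total, sum_distinct hij hki hkj, hi, hj, hk] at h1 h2 h3
    refine Prod.ext (triple_ext hij hki hkj ?_ ?_ ?_) ?_ <;>
      simp [hij, hki, hkj, hij.symm, hki.symm, hkj.symm] <;> omega

theorem pochPair_zero (q t : K) (l : ℤ) : pochPair q t l 0 = 1 := by
  simp [pochPair, qPoch_zero]

/-- A closed form for the partial sums, proved by telescoping. At n = d the right side contains
(q^{-4d}; q²)_{2d+1} = 0, so the full sum vanishes. -/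
theorem sum_pochPair {q t : K} (hqt : Generic q t) {d : ℤ} (hd : 0 < d) (n : ℕ) :
    (1 - t ^ 2 * q ^ (2 * d)) * (1 - q ^ (2 * -d))
        * ∑ e ∈ range (n + 1), q ^ (2 * (e : ℤ)) * pochPair q t (2 * d) (d + e)
          * (invPoch (q ^ 2) e * (qPoch (q ^ 2 * t ^ 2) (q ^ 2) e)⁻¹)
      = pochPair q t (2 * d) (d + n + 1)
          * (invPoch (q ^ 2) n * (qPoch (q ^ 2 * t ^ 2) (q ^ 2) n)⁻¹) := by
  have hq := hqt.q_ne_zero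
  induction n with
  | zero =>
    rw [zero_add, sum_range_one]
    simp only [Nat.cast_zero, add_zero]
    rw [pochPair_succ _ _ _ hd.le, ← zpow_add₀ hq, show 2 * d + -2 * (2 * d) = 2 * -d by ring]
    simp
    ring
  | succ n ih =>
    rw [sum_range_succ, mul_add, ih]
    push_cast
    have h1 := invPoch_succ hqt.notRootOfUnity n
    have h2 : (qPoch (q ^ 2 * t ^ 2) (q ^ 2) n)⁻¹
        = (1 - t ^ 2 * q ^ (2 * ((n : ℤ) + 1))) * (qPoch (q ^ 2 * t ^ 2) (q ^ 2) (n + 1))⁻¹ := by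
      have := hqt.one_sub_sq_mul_ne_zero (2 * ((n : ℤ) + 1))
      rw [qPoch_succ _ _ (by positivity), q_sq_zpow,
        show q ^ (2 * (n : ℤ)) * (q ^ 2 * t ^ 2) = t ^ 2 * q ^ (2 * ((n : ℤ) + 1)) by
          rw [mul_add, zpow_add₀ hq]; norm_cast; ring, mul_inv]
      field_simp
    rw [pochPair_succ _ _ _ (show (0 : ℤ) ≤ d + (n + 1) by positivity), ← h1, h2, q_sq_zpow,
      ← zpow_add₀ hq, show 2 * (d + ((n : ℤ) + 1)) + -2 * (2 * d) = 2 * (n + 1) + 2 * -d by ring,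
      show d + (n : ℤ) + 1 = d + (n + 1) by ring, zpow_add₀ hq,
      show 2 * (d + ((n : ℤ) + 1)) = 2 * d + 2 * (n + 1) by ring, zpow_add₀ hq]
    have h3 : q ^ (2 * d) * q ^ (2 * -d) = 1 := by rw [← zpow_add₀ hq]; simp
    linear_combination (t ^ 2 * q ^ (2 * ((n : ℤ) + 1)) * (1 - q ^ (2 * ((n : ℤ) + 1)))
      * (pochPair q t (2 * d) (d + (n + 1))) * invPoch (q ^ 2) (n + 1)
      * (qPoch (q ^ 2 * t ^ 2) (q ^ 2) (n + 1))⁻¹) * h3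

theorem phiExt_axis {q t : K} (hqt : Generic q t) {i j k : Fin 3} (hij : i ≠ j) (hki : k ≠ i)
    (hkj : k ≠ j) {l : Triple} {d : ℤ} (hd : 0 < d) (hi : l i = -d) (hj : l j = d)
    (hk : l k = d) : phiExt q t l = 0 := by
  have hq := hqt.q_ne_zero
  have ht := hqt.t_ne_zero
  have ua := unprime_eq hij hki hkj
  have ub := unprime_eq hij.symm hkj hki
  have uc := unprime_eq hki hkj.symm hij.symm
  have hl : unprime l i = 2 * d ∧ unprime l j = 0 ∧ unprime l k = 0 := by
    rw [ua, ub, uc]; omega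
  set F : ℕ → Triple := fun e => Pi.single i (d + e) with hF
  have hFi : Function.Injective F := fun a b h => by
    have := congrFun h i
    simp [hF] at this
    exact this
  obtain ⟨D, rfl⟩ := Int.eq_ofNat_of_zero_le hd.le
  -- Here `unprime l` is 2d in direction i and 0 in the others, so the cut-offs leave m = (d + e)
  -- δ^i with 0 ≤ e ≤ d, and `gIdx l m` is (-e, e, e).
  rw [phiExt, finsum_eq_sum_of_support_subset (s := (range (D + 1)).image F), sum_image hFi.injOn]
  · have hterm : ∀ e : ℕ, phiCoeff q t l (F e) • gPoly q t (gIdx l (F e))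
        = ((q ^ 2 / t) ^ (D : ℤ) * (q ^ (2 * (e : ℤ)) * pochPair q t (2 * D) (D + e)
          * (invPoch (q ^ 2) e * (qPoch (q ^ 2 * t ^ 2) (q ^ 2) e)⁻¹))) • (1 : Laurent K) := by
      intro e
      have F1 : F e i = D + e := by simp [hF]
      have F2 : F e j = 0 := by simp [hF, hij.symm]
      have F3 : F e k = 0 := by simp [hF, hki]
      rw [gPoly_axis t hij hki hkj (e := e), smul_smul]
      · congr 1
        rw [phiCoeff_eq q t hij hki hkj, F1, F2, F3, hi, hj, hk, pochPair_zero,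
          show (D : ℤ) + D = 2 * D by ring, show (D : ℤ) + e + 0 + 0 = D + e by ring,
          show (D : ℤ) + e - (-D + D + D) = e by ring, zpow_add₀ (div_ne_zero (pow_ne_zero 2 hq) ht), ← q_sq_zpow,
          div_zpow _ _ (e : ℤ)]
        have := zpow_ne_zero (e : ℤ) ht
        field_simp
      all_goals
        simp only [gIdx, total, sum_distinct hij hki hkj, F1, F2, F3, hi, hj, hk]
        ring
    rw [sum_congr rfl fun e _ => hterm e, ← sum_smul, ← mul_sum]
    have key := sum_pochPair hqt hd D
    rw [pochPair_eq_zero hq t (by positivity) (by omega), zero_mul] at key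
    have n1 := hqt.one_sub_sq_mul_ne_zero (2 * (D : ℤ))
    have n2 := hqt.one_sub_zpow_ne_zero (m := 2 * -(D : ℤ)) (by omega)
    rw [(mul_eq_zero.mp key).resolve_left (mul_ne_zero n1 n2)]
    simp
  · intro m hm
    have h1 : ∀ a, 0 ≤ 2 * m a - unprime l a := by
      intro a
      by_contra! h
      exact hm (by simp only; rw [gPoly_of_neg q t (a := a) (by rwa [unprime_gIdx]), smul_zero])
    have h2 : ∀ a, 0 ≤ unprime l a → m a ≤ unprime l a := by
      intro a ha
      by_contra! h
      exact hm (by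
        simp only
        rw [phiCoeff, prod_eq_zero (mem_univ a) (pochPair_eq_zero hq t ha h)]
        simp)
    have := h1 i
    have := h1 j
    have := h1 k
    have := h2 i (by omega)
    have := h2 j (by omega)
    have := h2 k (by omega)
    rw [coe_image]
    refine ⟨(m i - D).toNat, ?_, ?_⟩
    · simp
      omega
    · refine triple_ext hij hki hkj ?_ ?_ ?_ <;>
        simp [hF, hij, hki, hkj, hij.symm, hki.symm, hkj.symm] <;> omega

theorem pieriCoeff_one_one_ne_zero {q t : K} (hqt : Generic q t) {l : Triple} {i j k : Fin 3}
    (hi : 0 ≤ unprime l i) (hj : 0 ≤ unprime l j) (hk : 0 ≤ l k) :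
    pieriCoeff q t (unprime l) i j k 1 1 ≠ 0 := by
  have hq := hqt.q_ne_zero
  have ht := hqt.t_ne_zero
  rw [pieriCoeff, if_pos rfl, if_pos rfl, prime_unprime]
  exact div_ne_zero (div_ne_zero (mul_ne_zero (mul_ne_zero (pow_ne_zero 2 ht) (zpow_ne_zero _ hq))
    (mul_ne_zero (hqt.one_sub_sq_mul_ne_zero _) (hqt.one_sub_zpow_ne_zero (by omega))))
    (mul_ne_zero (hqt.one_sub_zpow_ne_zero (by omega)) (hqt.one_sub_zpow_ne_zero (by omega))))
    (mul_ne_zero (hqt.one_sub_sq_mul_ne_zero _) (hqt.one_sub_sq_mul_ne_zero _))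

/-- The Pieri rule at l - δ^k expresses `phiExt` at l, with nonzero coefficient, through triples
already treated: induction on n, which is l_k + l_i, and for fixed n on the depth d below the
boundary. It extends vanishing from n = 0 to all n. -/
theorem phiExt_eq_zero_of_base {q t : K} (hqt : Generic q t) {i j k : Fin 3} (hij : i ≠ j)
    (hki : k ≠ i) (hkj : k ≠ j) {m : ℤ} (hm : 0 ≤ m)
    (base : ∀ d > 0, ∀ l : Triple, l i = -d → l j = m + d → l k = d → phiExt q t l = 0) (n : ℕ) :
    ∀ (d : ℕ) (l : Triple), l i = -(d + 1) → l j = m + (d + 1) → l k = n + (d + 1) →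
      phiExt q t l = 0 := by
  have ua := unprime_eq hij hki hkj
  have ub := unprime_eq hij.symm hkj hki
  have uc := unprime_eq hki hkj.symm hij.symm
  induction n using Nat.strong_induction_on with
  | _ n ihn =>
    intro d
    induction d with
    | zero | succ d ihd =>
      intro l hi hj hk
      push_cast at hi hj hk
      rcases n with _ | n
      · exact base _ (by positivity) l hi hj (by simpa using hk)
      push_cast at hk
      obtain ⟨l', rfl⟩ : ∃ l', l = l' + Pi.single k 1 := ⟨l - Pi.single k 1, by simp⟩
      simp only [Pi.add_apply, Pi.single_eq_same, Pi.single_eq_of_ne hki.symm,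
        Pi.single_eq_of_ne hkj.symm, add_zero] at hi hj hk
      have hui : unprime l' i = l' j + l' k := ua l'
      have huj : unprime l' j = n := by rw [ub]; omega
      have huk : unprime l' k = m := by rw [uc]; omega
      have hl : ∀ a, 0 ≤ unprime l' a := by
        intro a
        rcases eq_or_of_distinct hij hki hkj a with rfl | rfl | rfl <;> omega
      have key := xPlusInv_mul_phiExt hqt hij hki hkj hl
      have z₀ : phiExt q t l' = 0 := ihn n (by omega) _ l' hi hj (by push_cast; omega)
      have ihn' : ∀ n' < n + 1, ∀ l : Triple, l i < 0 → l j = m - l i → l k = n' - l i →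
          phiExt q t l = 0 := fun n' hn' l h₁ h₂ h₃ =>
        ihn n' hn' (-l i - 1).toNat l (by omega) (by omega) (by omega)
      -- The target has a smaller n. If there is none, `unprime l' j` = 0 and the coefficient
      -- vanishes.
      have z₁ : pieriCoeff q t (unprime l') i j k 1 (-1)
          • phiExt q t (l' - Pi.single i 1 + Pi.single j 1) = 0 := by
        rcases n with _ | n
        · rw [pieriCoeff_eq_zero_right q t i k (by simpa using huj), zero_smul]
        · push_cast at hk
          rw [ihn' n (by omega), smul_zero] <;> simp [hij, hki, hkj, hij.symm] <;> omega
      have z₂ : pieriCoeff q t (unprime l') i j k (-1) (-1)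
          • phiExt q t (l' - Pi.single k 1) = 0 := by
        rcases n with _ | n
        · rw [pieriCoeff_eq_zero_right q t i k (by simpa using huj), zero_smul]
        · push_cast at hk
          rw [ihn' n (by omega), smul_zero] <;> simp [hki.symm, hkj.symm] <;> omega
      -- The target has the same n and depth one less. At depth 0 there is no induction hypothesis,
      -- but then l'_i = -1 and the coefficient contains 1 - q^{2(l'_i + 1)} = 0.
      have z₃ : pieriCoeff q t (unprime l') i j k (-1) 1
          • phiExt q t (l' + Pi.single i 1 - Pi.single j 1) = 0 := by
        first
        | rw [ihd, smul_zero] <;> simp [hij, hki, hkj, hij.symm] <;> omega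
        | simp [pieriCoeff, prime_unprime, hi]
      rw [z₀, z₁, z₂, z₃, mul_zero, add_zero, add_zero, add_zero] at key
      exact (smul_eq_zero.mp key.symm).resolve_left
        (pieriCoeff_one_one_ne_zero hqt (hl i) (hl j) (by omega))

/-- Two applications of `phiExt_eq_zero_of_base`, with j and k exchanged in the second, reduce the
claim to the axis (-d, d, d). -/
theorem phiExt_eq_zero {q t : K} (hqt : Generic q t) {l : Triple} (hl : ∀ a, 0 ≤ unprime l a)
    {i : Fin 3} (hi : l i < 0) : phiExt q t l = 0 := by
  obtain ⟨j, k, hjk, hij, hik⟩ := exists_distinct i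
  have hj := hl j
  have hk := hl k
  rw [unprime_eq hij.symm hjk.symm hik.symm] at hj
  rw [unprime_eq hik.symm hjk hij.symm] at hk
  obtain ⟨d, hd⟩ := Int.eq_ofNat_of_zero_le (show 0 ≤ -l i - 1 by omega)
  obtain ⟨m, hm⟩ := Int.eq_ofNat_of_zero_le (show 0 ≤ l j + l i by omega)
  obtain ⟨n, hn⟩ := Int.eq_ofNat_of_zero_le (show 0 ≤ l k + l i by omega)
  refine phiExt_eq_zero_of_base hqt hij hik.symm hjk.symm (m := m) (by positivity) ?_ n d l
    (by omega) (by omega) (by omega)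
  intro d hd l hi hj hk
  obtain ⟨d, rfl⟩ := Int.eq_ofNat_of_zero_le hd.le
  refine phiExt_eq_zero_of_base hqt hik hij.symm hjk (m := 0) le_rfl ?_ m (d - 1) l
    (by omega) (by omega) (by omega)
  intro d hd l hi hj hk
  exact phiExt_axis hqt hij hik.symm hjk.symm hd hi hk (by omega)

/-! ### Identification of φ with `phiExt` -/

theorem admissible_unprime_iff (l : Triple) : Admissible (unprime l) ↔ ∀ a, 0 ≤ l a := by
  have e : Even (total (unprime l)) := by rw [total_unprime]; exact even_two_mul _
  simp only [Admissible, e, true_and, Fin.forall_fin_succ, Fin.forall_fin_zero, and_true]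
  simp only [unprime, total, Fin.sum_univ_three]
  simp
  omega

theorem exists_eq_unprime {l : Triple} (h : Even (total l)) : ∃ l', l = unprime l' := by
  obtain ⟨c, hc⟩ := h
  refine ⟨fun a => c - l a, ?_⟩
  simp only [total, Fin.sum_univ_three] at hc
  funext a
  fin_cases a <;> simp [unprime, total, Fin.sum_univ_three] <;> omega

/-- The summation range for `m` in `phiExt`. -/
def phiExtRange (l : Triple) : Finset Triple :=
  (Icc 0 (unprime l)).filter fun m => ∀ a, unprime l a ≤ 2 * m a

theorem phiExt_eq_sum {q : K} (hq : q ≠ 0) (t : K) {l : Triple} (hl : ∀ a, 0 ≤ unprime l a) :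
    phiExt q t l = ∑ m ∈ phiExtRange l, ∑ x ∈ (hermiteIdx_region_finite (gIdx l m)).toFinset,
      ∑ r ∈ Icc 0 (hermiteIdx (gIdx l m) x),
        AddMonoidAlgebra.single (fun c => hermiteIdx (gIdx l m) x c - 2 * r c)
          (phiCoeff q t l m * (weight q t x.1 x.2 (hermiteIdx (gIdx l m) x)
            * ∏ c, invPoch (q ^ 2) (r c)
              * invPoch (q ^ 2) (hermiteIdx (gIdx l m) x c - r c))) := by
  rw [phiExt, finsum_eq_sum_of_support_subset (s := phiExtRange l)]
  · refine sum_congr rfl fun m _ => ?_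
    rw [gPoly, moment, finsum_eq_sum_of_support_subset _
      (s := (hermiteIdx_region_finite (gIdx l m)).toFinset)
      (by rw [Set.Finite.coe_toFinset]; exact momentTerm_support _ _ _ _ _), smul_sum]
    refine sum_congr rfl fun x _ => ?_
    have h0 : dot 0 x.1 = 0 := by simp [dot]
    rw [momentTerm, hermiteProd_eq_sum, smul_sum, smul_sum, h0]
    refine sum_congr rfl fun r _ => ?_
    rw [AddMonoidAlgebra.smul_single, AddMonoidAlgebra.smul_single]
    simp [mul_assoc]
  · intro m hm
    have h1 : ∀ a, unprime l a ≤ 2 * m a := by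
      intro a
      by_contra! h
      exact hm (by
        simp only
        rw [gPoly_of_neg q t (a := a) (by rw [unprime_gIdx]; omega), smul_zero])
    have h2 : ∀ a, m a ≤ unprime l a := by
      intro a
      by_contra! h
      exact hm (by
        simp only
        rw [phiCoeff, prod_eq_zero (mem_univ a) (pochPair_eq_zero hq t (hl a) h)]
        simp)
    rw [phiExtRange, coe_filter]
    refine ⟨mem_Icc.mpr ⟨fun a => ?_, h2⟩, h1⟩
    have := h1 a
    have := hl a
    simp only [Pi.zero_apply]
    omega

/-- After the change of variables the Pochhammer symbols agree one by one. What remains is the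
comparison of exponents: linear for q²/t (`e₁`) and quadratic for q (`e₃`). -/
theorem coeffC_eq {q t : K} (hqt : Generic q t) {l k r n : Triple} {s : ℤ} (hr : ∀ a, 0 ≤ r a)
    (hs : 0 ≤ s) (hp : ∀ a, 0 ≤ n a - unprime r a)
    (hu : ∀ a, 0 ≤ l a + r a - twicePrime k a)
    {m p h : Triple} (hm : m = fun a => n a + unprime l a - k a + s)
    (hp' : p = fun a => n a - unprime r a) (hh : h = fun a => l a + 2 * r a - twicePrime k a) :
    coeffC q t (unprime l) k r s n = phiCoeff q t l m * (weight q t p s h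
      * ∏ c, invPoch (q ^ 2) (r c) * invPoch (q ^ 2) (h c - r c)) := by
  have hq := hqt.q_ne_zero
  have ht := hqt.t_ne_zero
  have e₁ : total (unprime l) + total (unprime r) - total k + 2 * s
      = total m - (total p + s) := by
    simp only [hm, hp', total, unprime, Fin.sum_univ_three]; ring
  have e₂ : total n + total (unprime l) / 2 - total k + 3 * s = total m - total l := by
    rw [total_unprime, Int.mul_ediv_cancel_left _ (by norm_num)]
    simp only [hm, total, unprime, Fin.sum_univ_three]; ring
  have e₃ : total n ^ 2 - total (unprime r) ^ 2 + 3 * normSq (unprime r) - normSq n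
        - 2 * dot (unprime r) n + (s + 1) * (s + 2 * (total n - total (unprime r)))
        + 2 * (p 0 * (l 0 - twicePrime k 0) + p 1 * (l 1 - twicePrime k 1)
          + p 2 * (l 2 - twicePrime k 2))
      = 2 * (total p + s) + (total p ^ 2 - normSq p + 2 * dot p h + 2 * s * total p
        + s * (s - 1)) := by
    simp only [hh, hp', total, unprime, normSq, dot, twicePrime, Fin.sum_univ_three]
    ring
  have e₄ : ∀ a, l a + r a - twicePrime k a = h a - r a := fun a => by rw [hh]; ring
  have e₅ : ∀ a, n a - unprime r a = p a := fun a => by rw [hp']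
  have e₆ : ∀ a, n a + unprime l a - k a + s = m a := fun a => by rw [hm]
  have w : (q ^ 2 * t⁻¹) ^ (total (unprime l) + total (unprime r) - total k + 2 * s)
      * q ^ (total n ^ 2 - total (unprime r) ^ 2 + 3 * normSq (unprime r) - normSq n
        - 2 * dot (unprime r) n + (s + 1) * (s + 2 * (total n - total (unprime r))))
      * (q ^ (2 * p 0 * (l 0 - twicePrime k 0)) * q ^ (2 * p 1 * (l 1 - twicePrime k 1))
        * q ^ (2 * p 2 * (l 2 - twicePrime k 2)))
      = (q ^ 2 * t⁻¹) ^ total m * (t ^ (total p + s)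
        * q ^ (total p ^ 2 - normSq p + 2 * dot p h + 2 * s * total p + s * (s - 1))) := by
    generalize total n ^ 2 - total (unprime r) ^ 2 + 3 * normSq (unprime r) - normSq n
      - 2 * dot (unprime r) n + (s + 1) * (s + 2 * (total n - total (unprime r))) = X at *
    generalize total p ^ 2 - normSq p + 2 * dot p h + 2 * s * total p + s * (s - 1) = Y at *
    have e₃' : q ^ X * (q ^ (2 * p 0 * (l 0 - twicePrime k 0))
        * q ^ (2 * p 1 * (l 1 - twicePrime k 1)) * q ^ (2 * p 2 * (l 2 - twicePrime k 2)))
        = q ^ (2 * (total p + s)) * q ^ Y := by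
      rw [← zpow_add₀ hq, ← zpow_add₀ hq, ← zpow_add₀ hq, ← zpow_add₀ hq]
      congr 1
      linear_combination e₃
    rw [e₁, zpow_sub₀ (mul_ne_zero (pow_ne_zero 2 hq) (inv_ne_zero ht)), mul_zpow _ _ (_ + s),
      inv_zpow, q_sq_zpow]
    rw [mul_assoc, e₃']
    have := zpow_ne_zero (2 * (total p + s)) hq
    have := zpow_ne_zero (total p + s) ht
    field_simp
  simp only [e₅] at hp
  simp only [e₄] at hu
  rw [coeffC, phiCoeff, weight, ← e₂]
  simp only [prime_unprime, Fin.prod_univ_three, e₄, e₅, e₆, invPoch_of_nonneg _ hs,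
    invPoch_of_nonneg _ (hr _), invPoch_of_nonneg _ (hp _), invPoch_of_nonneg _ (hu _), pochPair]
  simp only [div_eq_mul_inv, mul_inv]
  linear_combination ((-1) ^ s * (qPoch (q ^ 2) (q ^ 2) s)⁻¹
    * (qPoch (q ^ 2 * t ^ 2) (q ^ 2) (total n + total (unprime l) / 2 - total k + 3 * s))⁻¹
    * (qPoch (t ^ 2) (q ^ 2) (m 0) * qPoch (q ^ (-2 * unprime l 0)) (q ^ 2) (m 0)
      * (qPoch (q ^ 2) (q ^ 2) (p 0))⁻¹ * (qPoch (q ^ 2) (q ^ 2) (r 0))⁻¹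
      * (qPoch (q ^ 2) (q ^ 2) (h 0 - r 0))⁻¹)
    * (qPoch (t ^ 2) (q ^ 2) (m 1) * qPoch (q ^ (-2 * unprime l 1)) (q ^ 2) (m 1)
      * (qPoch (q ^ 2) (q ^ 2) (p 1))⁻¹ * (qPoch (q ^ 2) (q ^ 2) (r 1))⁻¹
      * (qPoch (q ^ 2) (q ^ 2) (h 1 - r 1))⁻¹)
    * (qPoch (t ^ 2) (q ^ 2) (m 2) * qPoch (q ^ (-2 * unprime l 2)) (q ^ 2) (m 2)
      * (qPoch (q ^ 2) (q ^ 2) (p 2))⁻¹ * (qPoch (q ^ 2) (q ^ 2) (r 2))⁻¹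
      * (qPoch (q ^ 2) (q ^ 2) (h 2 - r 2))⁻¹)) * w

theorem phi_unprime {q t : K} (hqt : Generic q t) {l : Triple} (hl : ∀ a, 0 ≤ l a) :
    phi q t (unprime l) = phiExt q t l := by
  have hq := hqt.q_ne_zero
  have hl' : ∀ a, 0 ≤ unprime l a := ((admissible_unprime_iff l).mpr hl).1
  have hidx : ∀ k r n : Triple, ∀ s : ℤ,
      hermiteIdx (gIdx l fun a => n a + unprime l a - k a + s) (fun a => n a - unprime r a, s)
        = fun a => l a + 2 * r a - twicePrime k a := fun k r n s => by
    funext a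
    fin_cases a <;>
      simp [hermiteIdx, gIdx, unprime, twicePrime, total, Fin.sum_univ_three] <;> ring
  rw [phiExt_eq_sum hq t hl', phi, if_pos ((admissible_unprime_iff l).mpr hl)]
  simp only [sum_sigma']
  -- The constraints correspond: r_a ≤ n_a is p_a ≥ 0, n_a ≤ k_a - s is m_a ≤ `unprime l a`, and
  -- 2k_{ab} - l_{ab} ≤ r_{ab} says that the Hermite index r does not exceed the degree. The
  -- remaining bounds follow from these and nonnegativity.
  refine sum_nbij'
    (fun y => ⟨fun a => y.2.2.2 a + unprime l a - y.1 a + y.2.2.1,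
      ⟨(fun a => y.2.2.2 a - unprime y.2.1 a, y.2.2.1), y.2.1⟩⟩)
    (fun y => ⟨fun a => unprime l a + unprime y.2.2 a - y.1 a + y.2.1.1 a + y.2.1.2,
      (y.2.2, y.2.1.2, fun a => y.2.1.1 a + unprime y.2.2 a)⟩) ?_ ?_ ?_ ?_ ?_
  · rintro ⟨k, r, s, n⟩ hy
    simp only [mem_sigma, Set.Finite.mem_toFinset, kSet, polytope, Set.mem_ofPred_eq,
      prime_unprime] at hy
    obtain ⟨⟨hk, hkl⟩, hr, hs, hn, hru, hrn⟩ := hy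
    have ineq : ∀ a, 0 ≤ n a + unprime l a - k a + s ∧ n a + unprime l a - k a + s ≤ unprime l a
        ∧ unprime l a ≤ 2 * (n a + unprime l a - k a + s) ∧ 0 ≤ l a + 2 * r a - twicePrime k a
        ∧ r a ≤ l a + 2 * r a - twicePrime k a := by
      simp only [Fin.forall_fin_succ, Fin.forall_fin_zero, unprime, twicePrime, total,
        Fin.sum_univ_three] at *
      simp at *
      omega
    simp only [mem_sigma, Set.Finite.mem_toFinset, Set.mem_ofPred_eq, hidx, phiExtRange,
      mem_filter, mem_Icc, Pi.le_def]
    exact ⟨⟨⟨fun a => (ineq a).1, fun a => (ineq a).2.1⟩, fun a => (ineq a).2.2.1⟩,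
      ⟨fun a => by have := (hrn a).1; omega, hs, fun a => (ineq a).2.2.2.1⟩,
      hr, fun a => (ineq a).2.2.2.2⟩
  · rintro ⟨m, ⟨p, s⟩, r⟩ hy
    simp only [mem_sigma, Set.Finite.mem_toFinset, Set.mem_ofPred_eq, phiExtRange,
      mem_filter, mem_Icc, Pi.le_def, hermiteIdx, gIdx] at hy
    simp only [mem_sigma, Set.Finite.mem_toFinset, kSet, polytope, Set.mem_ofPred_eq,
      prime_unprime]
    simp only [Fin.forall_fin_succ, Fin.forall_fin_zero, unprime, twicePrime, total,
      Fin.sum_univ_three] at *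
    simp at *
    omega
  · rintro ⟨k, r, s, n⟩ hy
    simp
    funext a
    ring
  · rintro ⟨m, ⟨p, s⟩, r⟩ hy
    simp
    funext a
    ring
  · rintro ⟨k, r, s, n⟩ hy
    simp only [mem_sigma, Set.Finite.mem_toFinset, kSet, polytope, Set.mem_ofPred_eq,
      prime_unprime] at hy
    obtain ⟨-, hr, hs, hn, hru, hrn⟩ := hy
    simp only [hidx]
    congr 1
    · funext c
      rw [prime_unprime]; ring
    · exact coeffC_eq hqt hr hs (fun a => by have := (hrn a).1; omega)
        (fun a => by have := hru a; omega) rfl rfl rfl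

/-! ### The Pieri rule for φ -/

theorem sum_signs {M : Type*} [AddCommMonoid M] (f : ℤ → M) : ∑ a ∈ signs, f a = f 1 + f (-1) :=
  sum_pair (by norm_num)

theorem phi_unprime_of_nonneg {q t : K} (hqt : Generic q t) {l : Triple}
    (hl : ∀ a, 0 ≤ unprime l a) : phi q t (unprime l) = phiExt q t l := by
  by_cases h : ∀ a, 0 ≤ l a
  · exact phi_unprime hqt h
  · rw [phi, if_neg (mt (admissible_unprime_iff l).mp h)]
    push Not at h
    obtain ⟨i, hi⟩ := h
    exact (phiExt_eq_zero hqt hl hi).symm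

theorem shift_unprime_add_add {i j k : Fin 3} (hij : i ≠ j) (hki : k ≠ i) (hkj : k ≠ j) (l : Triple) :
    shift (unprime l) i j 1 1 = unprime (l + Pi.single k 1) := by
  refine triple_ext hij hki hkj ?_ ?_ ?_ <;>
    simp [shift, unprime, total, sum_distinct hij hki hkj, hij, hij.symm, hki, hki.symm, hkj,
      hkj.symm] <;> ring

theorem shift_unprime_add_sub {i j k : Fin 3} (hij : i ≠ j) (hki : k ≠ i) (hkj : k ≠ j) (l : Triple) :
    shift (unprime l) i j 1 (-1) = unprime (l - Pi.single i 1 + Pi.single j 1) := by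
  refine triple_ext hij hki hkj ?_ ?_ ?_ <;>
    simp [shift, unprime, total, sum_distinct hij hki hkj, hij, hij.symm, hki, hki.symm, hkj,
      hkj.symm] <;> ring

theorem shift_unprime_sub_add {i j k : Fin 3} (hij : i ≠ j) (hki : k ≠ i) (hkj : k ≠ j) (l : Triple) :
    shift (unprime l) i j (-1) 1 = unprime (l + Pi.single i 1 - Pi.single j 1) := by
  refine triple_ext hij hki hkj ?_ ?_ ?_ <;>
    simp [shift, unprime, total, sum_distinct hij hki hkj, hij, hij.symm, hki, hki.symm, hkj,
      hkj.symm] <;> ring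

theorem shift_unprime_sub_sub {i j k : Fin 3} (hij : i ≠ j) (hki : k ≠ i) (hkj : k ≠ j) (l : Triple) :
    shift (unprime l) i j (-1) (-1) = unprime (l - Pi.single k 1) := by
  refine triple_ext hij hki hkj ?_ ?_ ?_ <;>
    simp [shift, unprime, total, sum_distinct hij hki hkj, hij, hij.symm, hki, hki.symm, hkj,
      hkj.symm] <;> ring

/-- A negative entry of the shifted triple can only come from lowering a zero entry, and then the
coefficient is 0. Otherwise φ and `phiExt` agree, both being 0 if a triangle inequality fails. -/
theorem pieriCoeff_smul_phi {q t : K} (hqt : Generic q t) {i j : Fin 3} (hij : i ≠ j) (k : Fin 3)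
    {l l' : Triple} (hl : ∀ a, 0 ≤ l a) {a b : ℤ} (ha : a ∈ signs) (hb : b ∈ signs)
    (hl' : shift l i j a b = unprime l') :
    pieriCoeff q t l i j k a b • phi q t (shift l i j a b)
      = pieriCoeff q t l i j k a b • phiExt q t l' := by
  simp only [signs, mem_insert, mem_singleton] at ha hb
  by_cases h : ∀ a, 0 ≤ unprime l' a
  · rw [hl', phi_unprime_of_nonneg hqt h]
  · suffices pieriCoeff q t l i j k a b = 0 by rw [this, zero_smul, zero_smul]
    push Not at h
    obtain ⟨c, hc⟩ := h
    rw [← hl'] at hc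
    have h1 := hl c
    simp only [shift, Pi.add_apply] at hc
    by_cases hci : c = i
    · subst hci
      rcases ha with rfl | rfl
      · simp [hij] at hc
        omega
      · exact pieriCoeff_eq_zero_left q t j k (by simp [hij] at hc; omega) b
    · by_cases hcj : c = j
      · subst hcj
        rcases hb with rfl | rfl
        · simp [hij.symm] at hc
          omega
        · exact pieriCoeff_eq_zero_right q t i k (by simp [hij.symm] at hc; omega) a
      · simp [hci, hcj] at hc
        omega

theorem xPlusInv_mul_phi {q t : K} (hqt : Generic q t) {l : Triple} (hl : Admissible l)
    {i j k : Fin 3} (hij : i ≠ j) (hki : k ≠ i) (hkj : k ≠ j) :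
    xPlusInv K k * phi q t l = ∑ a ∈ signs, ∑ b ∈ signs,
      pieriCoeff q t l i j k a b • phi q t (shift l i j a b) := by
  obtain ⟨l, rfl⟩ := exists_eq_unprime hl.2.1
  have h1 : (1 : ℤ) ∈ signs := by simp [signs]
  have h2 : (-1 : ℤ) ∈ signs := by simp [signs]
  simp only [sum_signs]
  rw [pieriCoeff_smul_phi hqt hij k hl.1 h1 h1 (shift_unprime_add_add hij hki hkj l),
    pieriCoeff_smul_phi hqt hij k hl.1 h1 h2 (shift_unprime_add_sub hij hki hkj l),
    pieriCoeff_smul_phi hqt hij k hl.1 h2 h1 (shift_unprime_sub_add hij hki hkj l),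
    pieriCoeff_smul_phi hqt hij k hl.1 h2 h2 (shift_unprime_sub_sub hij hki hkj l),
    phi_unprime_of_nonneg hqt hl.1, xPlusInv_mul_phiExt hqt hij hki hkj hl.1, ← add_assoc]

theorem pieriPrefactor_mul_pieriA {q t : K} (hqt : Generic q t) {l : Triple} {i j : Fin 3}
    (k : Fin 3) (hi : l i ≠ 0) (hj : l j ≠ 0) (a b : ℤ) :
    pieriPrefactor q t l i j * pieriA q t l i j k a b = pieriCoeff q t l i j k a b := by
  have n₁ := hqt.one_sub_zpow_ne_zero (m := 2 * l i) (by omega)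
  have n₂ := hqt.one_sub_zpow_ne_zero (m := 2 * l j) (by omega)
  simp only [pieriPrefactor, pieriA, pieriCoeff]
  split_ifs <;> simp only [div_eq_mul_inv, mul_inv] <;> field_simp

/-! ### The ratio of the normalizations -/

/-- The ratio of the two normalizations. -/
def normRatio (q t : K) (l : Triple) : K :=
  (t * q ^ (-2 : ℤ)) ^ (total l / 2) * (normX7 q t l / normAS q t l)

/-- The factor of `normRatio` that depends on half the sum of the entries. -/
def normTotal (q t : K) (n : ℤ) : K :=
  (t * q ^ (-2 : ℤ)) ^ n * qPoch (t ^ 2 * q ^ 2) (q ^ 2) n / qPoch (t ^ 4) (q ^ 2) n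

/-- The factor of `normRatio` that depends on an entry of `l'`. -/
def normPrime (q t : K) (n : ℤ) : K := qPoch (q ^ 2) (q ^ 2) n / qPoch (t ^ 2) (q ^ 2) n

/-- The factor of `normRatio` that depends on an entry of `l`. -/
def normEntry (q t : K) (n : ℤ) : K :=
  q ^ (n ^ 2) * qPoch (t ^ 4) (q ^ 2) n / (qPoch (q ^ 2) (q ^ 2) n * qPoch (t ^ 2) (q ^ 2) n)

/-- Each factor depends on a single integer that a Pieri shift moves by at most one, so only the
successor formulas for the three factors are needed. -/
theorem normRatio_unprime {q : K} (hq : q ≠ 0) (t : K) {i j k : Fin 3} (hij : i ≠ j) (hki : k ≠ i)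
    (hkj : k ≠ j) (l : Triple) :
    normRatio q t (unprime l) = normTotal q t (l i + l j + l k)
      * (normPrime q t (l i) * normPrime q t (l j) * normPrime q t (l k))
      * (normEntry q t (l j + l k) * normEntry q t (l i + l k) * normEntry q t (l i + l j)) := by
  rw [normRatio, normX7, normAS, total_unprime, Int.mul_ediv_cancel_left _ (by norm_num),
    prod_distinct hij hki hkj, prod_distinct hij hki hkj, normSq, sum_distinct hij hki hkj, total,
    sum_distinct hij hki hkj]
  simp only [prime_unprime, unprime_eq hij hki hkj, unprime_eq hij.symm hkj hki,
    unprime_eq hki hkj.symm hij.symm, normTotal, normPrime, normEntry, zpow_add₀ hq,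
    div_eq_mul_inv, mul_inv, inv_inv]
  ring

theorem normTotal_succ {q t : K} (hqt : Generic q t) {n : ℤ} (hn : 0 ≤ n) :
    normTotal q t (n + 1) = normTotal q t n
      * (t * (1 - t ^ 2 * (q * q ^ n) ^ 2) / (q ^ 2 * (1 - t ^ 4 * (q ^ n) ^ 2))) := by
  have hq := hqt.q_ne_zero
  have h : t * q ^ (-2 : ℤ) ≠ 0 := mul_ne_zero hqt.t_ne_zero (zpow_ne_zero _ hq)
  have e : (q ^ 2) ^ n = (q ^ n) ^ 2 := by
    rw [← zpow_natCast, ← zpow_natCast, ← zpow_mul, ← zpow_mul, mul_comm]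
  rw [normTotal, normTotal, qPoch_succ _ _ hn, qPoch_succ _ _ hn, zpow_add₀ h, zpow_one, e,
    show q ^ (-2 : ℤ) = (q ^ 2)⁻¹ by rw [zpow_neg]; norm_cast]
  simp only [div_eq_mul_inv, mul_inv]
  ring

theorem normPrime_succ (q t : K) {n : ℤ} (hn : 0 ≤ n) :
    normPrime q t (n + 1) = normPrime q t n
      * ((1 - (q * q ^ n) ^ 2) / (1 - t ^ 2 * (q ^ n) ^ 2)) := by
  have e : (q ^ 2) ^ n = (q ^ n) ^ 2 := by
    rw [← zpow_natCast, ← zpow_natCast, ← zpow_mul, ← zpow_mul, mul_comm]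
  rw [normPrime, normPrime, qPoch_succ _ _ hn, qPoch_succ _ _ hn, e]
  simp only [div_eq_mul_inv, mul_inv]
  ring

theorem normEntry_succ {q : K} (hq : q ≠ 0) (t : K) {n : ℤ} (hn : 0 ≤ n) :
    normEntry q t (n + 1) = normEntry q t n
      * (q * (q ^ n) ^ 2 * (1 - t ^ 4 * (q ^ n) ^ 2)
        / ((1 - (q * q ^ n) ^ 2) * (1 - t ^ 2 * (q ^ n) ^ 2))) := by
  have e : (q ^ 2) ^ n = (q ^ n) ^ 2 := by
    rw [← zpow_natCast, ← zpow_natCast, ← zpow_mul, ← zpow_mul, mul_comm]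
  have e' : q ^ ((n + 1) ^ 2) = q ^ (n ^ 2) * (q * (q ^ n) ^ 2) := by
    rw [show (n + 1) ^ 2 = n ^ 2 + 1 + (n + n) by ring, zpow_add₀ hq, zpow_add₀ hq, zpow_add₀ hq,
      zpow_one]
    ring
  rw [normEntry, normEntry, qPoch_succ _ _ hn, qPoch_succ _ _ hn, qPoch_succ _ _ hn, e, e']
  simp only [div_eq_mul_inv, mul_inv]
  ring

/-! ### The Arthamonov–Shakirov coefficients in product form -/

theorem bracket_eq {q t : K} (hqt : Generic q t) (n m : ℤ) :
    bracket q t n m = -(1 - (t ^ m) ^ 2 * (q ^ n) ^ 2) / (q ^ n * t ^ m * (q - q⁻¹)) := by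
  have h1 := zpow_ne_zero n hqt.q_ne_zero
  have h2 := zpow_ne_zero m hqt.t_ne_zero
  rw [bracket, zpow_neg, zpow_neg]
  by_cases h : q - q⁻¹ = 0
  · simp [h]
  · field_simp
    ring

theorem bracket_two {q t : K} (hqt : Generic q t) (n : ℤ) :
    bracket q t n 2 = -(1 - t ^ 4 * (q ^ n) ^ 2) / (q ^ n * t ^ 2 * (q - q⁻¹)) := by
  rw [bracket_eq hqt, show t ^ (2 : ℤ) = t ^ 2 by norm_cast, ← pow_mul]

theorem bracket_one {q t : K} (hqt : Generic q t) (n : ℤ) :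
    bracket q t n 1 = -(1 - t ^ 2 * (q ^ n) ^ 2) / (q ^ n * t * (q - q⁻¹)) := by
  rw [bracket_eq hqt, zpow_one]

theorem bracket_zero {q t : K} (hqt : Generic q t) (n : ℤ) :
    bracket q t n 0 = -(1 - (q ^ n) ^ 2) / (q ^ n * (q - q⁻¹)) := by
  rw [bracket_eq hqt, zpow_zero, one_pow, one_mul, mul_one]

theorem bracket_neg (q t : K) (n m : ℤ) : bracket q t (-n) (-m) = -bracket q t n m := by
  rw [bracket, bracket, neg_neg, neg_neg, ← neg_div, neg_sub]

theorem Generic.sub_inv_ne_zero {q t : K} (h : Generic q t) : q - q⁻¹ ≠ 0 := fun h0 => by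
  have h1 : 1 - q ^ (2 : ℤ) = 0 := by
    have hq := h.q_ne_zero
    field_simp at h0
    norm_cast
    linear_combination -h0
  exact h.one_sub_zpow_ne_zero (by norm_num) h1

theorem Generic.sq_mul_sq_sub_ne_zero {q t : K} (h : Generic q t) {n m : ℤ}
    (hnm : n ≠ 0 ∨ m ≠ 0) : 1 - (t ^ m) ^ 2 * (q ^ n) ^ 2 ≠ 0 := by
  have := h.one_sub_ne_zero (m := n * 2) (n := m * 2) (by omega)
  rw [zpow_mul, zpow_mul, mul_comm] at this
  exact_mod_cast this

theorem Generic.one_sub_t_four_ne_zero {q t : K} (h : Generic q t) (n : ℤ) :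
    1 - t ^ 4 * (q ^ n) ^ 2 ≠ 0 := by
  simpa [← pow_mul] using h.sq_mul_sq_sub_ne_zero (n := n) (m := 2) (by norm_num)

theorem Generic.one_sub_t_two_ne_zero {q t : K} (h : Generic q t) (n : ℤ) :
    1 - t ^ 2 * (q ^ n) ^ 2 ≠ 0 := by
  simpa using h.sq_mul_sq_sub_ne_zero (n := n) (m := 1) (by norm_num)

theorem Generic.one_sub_sq_ne_zero {q t : K} (h : Generic q t) {n : ℤ} (hn : n + 1 ≠ 0) :
    1 - (q * q ^ n) ^ 2 ≠ 0 := by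
  simpa [zpow_add₀ h.q_ne_zero, mul_comm] using
    h.sq_mul_sq_sub_ne_zero (n := n + 1) (m := 0) (Or.inl hn)

theorem bracket_ne_zero {q t : K} (h : Generic q t) {n m : ℤ} (hnm : n ≠ 0 ∨ m ≠ 0) :
    bracket q t n m ≠ 0 := by
  rw [bracket_eq h]
  refine div_ne_zero (neg_ne_zero.mpr (h.sq_mul_sq_sub_ne_zero hnm)) ?_
  exact mul_ne_zero (mul_ne_zero (zpow_ne_zero _ h.q_ne_zero) (zpow_ne_zero _ h.t_ne_zero))
    h.sub_inv_ne_zero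

/-- For a raised index the factor [l_i - 1, 2] occurs in numerator and denominator; it is nonzero by
genericity, as t enters with exponent 2. -/
theorem asCoeff_add_add {q t : K} (hqt : Generic q t) {i j k : Fin 3} (hij : i ≠ j)
    (hki : k ≠ i) (hkj : k ≠ j) (l : Triple) :
    asCoeff q t (unprime l) i j k 1 1
      = bracket q t (l i + l j + l k) 2 * bracket q t (l k) 1
        / (bracket q t (l j + l k) 2 * bracket q t (l i + l k) 2) := by
  have n₁ := bracket_ne_zero hqt (n := l j + l k - 1) (m := 2) (by norm_num)
  have n₂ := bracket_ne_zero hqt (n := l i + l k - 1) (m := 2) (by norm_num)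
  rw [asCoeff, unprime_eq hij hki hkj, unprime_eq hij.symm hkj hki,
    unprime_eq hki hkj.symm hij.symm,
    show (1 * (l j + l k) + 1 * (l i + l k) + (l i + l j)) / 2 = l i + l j + l k by omega,
    show (1 * (l j + l k) + 1 * (l i + l k) - (l i + l j)) / 2 = l k by omega]
  norm_num
  field_simp

theorem asCoeff_add_sub {q t : K} (hqt : Generic q t) {i j k : Fin 3} (hij : i ≠ j)
    (hki : k ≠ i) (hkj : k ≠ j) (l : Triple) :
    asCoeff q t (unprime l) i j k 1 (-1)
      = -(bracket q t (l j) 1 * bracket q t (-l i) 0 * bracket q t (l i + l k - 1) 2)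
        / (bracket q t (l j + l k) 2 * bracket q t (l i + l k) 1
          * bracket q t (l i + l k - 1) 1) := by
  have n₁ := bracket_ne_zero hqt (n := l j + l k - 1) (m := 2) (by norm_num)
  rw [asCoeff, unprime_eq hij hki hkj, unprime_eq hij.symm hkj hki,
    unprime_eq hki hkj.symm hij.symm,
    show (1 * (l j + l k) + -1 * (l i + l k) + (l i + l j)) / 2 = l j by omega,
    show (1 * (l j + l k) + -1 * (l i + l k) - (l i + l j)) / 2 = -l i by omega]
  norm_num
  field_simp

theorem asCoeff_sub_sub (q t : K) {i j k : Fin 3} (hij : i ≠ j) (hki : k ≠ i) (hkj : k ≠ j)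
    (l : Triple) :
    asCoeff q t (unprime l) i j k (-1) (-1)
      = bracket q t (-l k) 0 * bracket q t (-(l i + l j + l k)) (-1)
          * bracket q t (l j + l k - 1) 2 * bracket q t (l i + l k - 1) 2
        / (bracket q t (l j + l k) 1 * bracket q t (l j + l k - 1) 1 * bracket q t (l i + l k) 1
          * bracket q t (l i + l k - 1) 1) := by
  rw [asCoeff, unprime_eq hij hki hkj, unprime_eq hij.symm hkj hki,
    unprime_eq hki hkj.symm hij.symm,
    show (-1 * (l j + l k) + -1 * (l i + l k) + (l i + l j)) / 2 = -l k by omega,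
    show (-1 * (l j + l k) + -1 * (l i + l k) - (l i + l j)) / 2 = -(l i + l j + l k) by omega]
  norm_num

theorem asCoeff_swap (q t : K) (l : Triple) (i j k : Fin 3) (a b : ℤ) :
    asCoeff q t l i j k a b = asCoeff q t l j i k b a := by
  rw [asCoeff, asCoeff, add_comm (a * l i), add_comm a b]
  congr 1 <;> ring

theorem pieriCoeff_swap (q t : K) (l : Triple) (i j k : Fin 3) :
    pieriCoeff q t l i j k (-1) 1 = pieriCoeff q t l j i k 1 (-1) := by
  simp [pieriCoeff, mul_comm (1 - t ^ 2 * q ^ (2 * l i))]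

theorem asCoeff_add_add_eq {q t : K} (hqt : Generic q t) {i j k : Fin 3} (hij : i ≠ j)
    (hki : k ≠ i) (hkj : k ≠ j) (l : Triple) :
    asCoeff q t (unprime l) i j k 1 1
      = t * (1 - t ^ 4 * (q ^ (l i + l j + l k)) ^ 2) * (1 - t ^ 2 * (q ^ l k) ^ 2)
        / ((1 - t ^ 4 * (q ^ (l j + l k)) ^ 2) * (1 - t ^ 4 * (q ^ (l i + l k)) ^ 2)) := by
  have hq := hqt.q_ne_zero
  have ht := hqt.t_ne_zero
  have hw := hqt.sub_inv_ne_zero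
  rw [asCoeff_add_add hqt hij hki hkj, bracket_two hqt, bracket_two hqt, bracket_two hqt,
    bracket_one hqt]
  have n₃ := hqt.one_sub_t_four_ne_zero (l j + l k)
  have n₄ := hqt.one_sub_t_four_ne_zero (l i + l k)
  have h : q ^ (l j + l k) * q ^ (l i + l k) = q ^ (l i + l j + l k) * q ^ l k := by
    rw [← zpow_add₀ hq, ← zpow_add₀ hq]; congr 1; ring
  have a₀ := zpow_ne_zero (l j + l k) hq
  have b₀ := zpow_ne_zero (l i + l k) hq
  have c₀ := zpow_ne_zero (l k) hq
  have s₀ := zpow_ne_zero (l i + l j + l k) hq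
  generalize 1 - t ^ 4 * (q ^ (l i + l j + l k)) ^ 2 = D₁ at *
  generalize 1 - t ^ 2 * (q ^ l k) ^ 2 = D₂ at *
  generalize 1 - t ^ 4 * (q ^ (l j + l k)) ^ 2 = D₃ at *
  generalize 1 - t ^ 4 * (q ^ (l i + l k)) ^ 2 = D₄ at *
  generalize q ^ (l j + l k) = a at *
  generalize q ^ (l i + l k) = b at *
  generalize q ^ l k = c at *
  generalize q ^ (l i + l j + l k) = s at *
  generalize q - q⁻¹ = w at *
  -- The monomial denominators of the brackets leave the factor ab/(sc), which is 1 by `h`.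
  trans (a * b) / (s * c) * (t * D₁ * D₂ / (D₃ * D₄))
  · field_simp
  · rw [h, div_self (mul_ne_zero s₀ c₀), one_mul]

theorem asCoeff_sub_sub_eq {q t : K} (hqt : Generic q t) {i j k : Fin 3} (hij : i ≠ j)
    (hki : k ≠ i) (hkj : k ≠ j) (l : Triple) :
    asCoeff q t (unprime (l + Pi.single k 1)) i j k (-1) (-1)
      = t⁻¹ * ((1 - (q * q ^ l k) ^ 2) * (1 - t ^ 2 * (q * q ^ (l i + l j + l k)) ^ 2)
          * (1 - t ^ 4 * (q ^ (l j + l k)) ^ 2) * (1 - t ^ 4 * (q ^ (l i + l k)) ^ 2))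
        / ((1 - t ^ 2 * (q * q ^ (l j + l k)) ^ 2) * (1 - t ^ 2 * (q ^ (l j + l k)) ^ 2)
          * (1 - t ^ 2 * (q * q ^ (l i + l k)) ^ 2) * (1 - t ^ 2 * (q ^ (l i + l k)) ^ 2)) := by
  have hq := hqt.q_ne_zero
  have ht := hqt.t_ne_zero
  have hw := hqt.sub_inv_ne_zero
  have z' : ∀ n : ℤ, q ^ (n + 1) = q * q ^ n := fun n => by
    rw [zpow_add₀ hq, zpow_one, mul_comm]
  rw [asCoeff_sub_sub q t hij hki hkj]
  simp only [Pi.add_apply, Pi.single_eq_same, Pi.single_eq_of_ne hki.symm,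
    Pi.single_eq_of_ne hkj.symm, add_zero, ← add_assoc, add_sub_cancel_right, bracket_neg]
  have e₁ := hqt.one_sub_t_two_ne_zero (l j + l k + 1)
  have e₂ := hqt.one_sub_t_two_ne_zero (l i + l k + 1)
  rw [← neg_zero, bracket_neg, bracket_two hqt, bracket_two hqt,
    bracket_one hqt, bracket_one hqt, bracket_one hqt, bracket_one hqt, bracket_one hqt,
    bracket_zero hqt]
  simp only [z'] at e₁ e₂ ⊢
  have n₃ := hqt.one_sub_t_two_ne_zero (l j + l k)
  have n₄ := hqt.one_sub_t_two_ne_zero (l i + l k)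
  have h : q ^ (l j + l k) * q ^ (l i + l k) = q ^ (l i + l j + l k) * q ^ l k := by
    rw [← zpow_add₀ hq, ← zpow_add₀ hq]; congr 1; ring
  have a₀ := zpow_ne_zero (l j + l k) hq
  have b₀ := zpow_ne_zero (l i + l k) hq
  have c₀ := zpow_ne_zero (l k) hq
  have s₀ := zpow_ne_zero (l i + l j + l k) hq
  generalize 1 - t ^ 4 * (q ^ (l j + l k)) ^ 2 = D₃ at *
  generalize 1 - t ^ 4 * (q ^ (l i + l k)) ^ 2 = D₄ at *
  generalize 1 - t ^ 2 * (q ^ (l j + l k)) ^ 2 = D₅ at *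
  generalize 1 - t ^ 2 * (q ^ (l i + l k)) ^ 2 = D₆ at *
  generalize 1 - (q * q ^ l k) ^ 2 = D₉ at *
  generalize 1 - t ^ 2 * (q * q ^ (l j + l k)) ^ 2 = E₁ at *
  generalize 1 - t ^ 2 * (q * q ^ (l i + l k)) ^ 2 = E₂ at *
  generalize 1 - t ^ 2 * (q * q ^ (l i + l j + l k)) ^ 2 = E₃ at *
  generalize q ^ (l j + l k) = a at *
  generalize q ^ (l i + l k) = b at *
  generalize q ^ l k = c at *
  generalize q ^ (l i + l j + l k) = s at *
  generalize q - q⁻¹ = w at *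
  trans (a * b) / (s * c) * (t⁻¹ * (D₉ * E₃ * D₃ * D₄) / (E₁ * D₅ * E₂ * D₆))
  · field_simp
  · rw [h, div_self (mul_ne_zero s₀ c₀), one_mul]

theorem asCoeff_add_sub_eq {q t : K} (hqt : Generic q t) {i j k : Fin 3} (hij : i ≠ j)
    (hki : k ≠ i) (hkj : k ≠ j) (l : Triple) :
    asCoeff q t (unprime (l + Pi.single i 1)) i j k 1 (-1)
      = t * (q ^ (l i + l k) / q ^ l i) ^ 2
        * ((1 - t ^ 2 * (q ^ l j) ^ 2) * (1 - (q * q ^ l i) ^ 2)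
          * (1 - t ^ 4 * (q ^ (l i + l k)) ^ 2))
        / ((1 - t ^ 4 * (q ^ (l j + l k)) ^ 2) * (1 - t ^ 2 * (q * q ^ (l i + l k)) ^ 2)
          * (1 - t ^ 2 * (q ^ (l i + l k)) ^ 2)) := by
  have hq := hqt.q_ne_zero
  have ht := hqt.t_ne_zero
  have hw := hqt.sub_inv_ne_zero
  have z' : ∀ n : ℤ, q ^ (n + 1) = q * q ^ n := fun n => by
    rw [zpow_add₀ hq, zpow_one, mul_comm]
  rw [asCoeff_add_sub hqt hij hki hkj]
  simp only [Pi.add_apply, Pi.single_eq_same, Pi.single_eq_of_ne hki,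
    Pi.single_eq_of_ne hij.symm, add_zero, add_right_comm _ (1 : ℤ) (l k), add_sub_cancel_right]
  have e₂ := hqt.one_sub_t_two_ne_zero (l i + l k + 1)
  rw [← neg_zero, bracket_neg, bracket_two hqt,
    bracket_two hqt, bracket_one hqt, bracket_one hqt, bracket_one hqt, bracket_zero hqt]
  simp only [z'] at e₂ ⊢
  have n₁ := hqt.one_sub_t_four_ne_zero (l j + l k)
  have n₄ := hqt.one_sub_t_two_ne_zero (l i + l k)
  have h : q ^ l j = q ^ (l j + l k) * q ^ l i / q ^ (l i + l k) := by
    rw [← zpow_add₀ hq, ← zpow_sub₀ hq]; congr 1; ring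
  have a₀ := zpow_ne_zero (l j + l k) hq
  have b₀ := zpow_ne_zero (l i + l k) hq
  have c₀ := zpow_ne_zero (l i) hq
  generalize 1 - t ^ 4 * (q ^ (l j + l k)) ^ 2 = D₁ at *
  generalize 1 - t ^ 4 * (q ^ (l i + l k)) ^ 2 = D₂ at *
  generalize 1 - t ^ 2 * (q ^ l j) ^ 2 = D₄ at *
  generalize 1 - t ^ 2 * (q ^ (l i + l k)) ^ 2 = D₆ at *
  generalize 1 - (q * q ^ l i) ^ 2 = D₉ at *
  generalize 1 - t ^ 2 * (q * q ^ (l i + l k)) ^ 2 = E₂ at *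
  rw [h]
  generalize q ^ (l j + l k) = a at *
  generalize q ^ (l i + l k) = b at *
  generalize q ^ l i = c at *
  generalize q - q⁻¹ = w at *
  field_simp

/-! ### Conjugation of the Pieri coefficients by the ratio -/

theorem asCoeff_mul_normRatio_add_add {q t : K} (hqt : Generic q t) {i j k : Fin 3} (hij : i ≠ j)
    (hki : k ≠ i) (hkj : k ≠ j) {l : Triple} (hl : ∀ a, 0 ≤ l a) :
    asCoeff q t (unprime l) i j k 1 1 * normRatio q t (unprime (l + Pi.single k 1))
      = normRatio q t (unprime l) * pieriCoeff q t (unprime l) i j k 1 1 := by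
  have hq := hqt.q_ne_zero
  have ht := hqt.t_ne_zero
  have hi := hl i
  have hj := hl j
  have hk := hl k
  have p : pieriCoeff q t (unprime l) i j k 1 1
      = t ^ 2 * (q ^ (l j + l k) * q ^ (l i + l k)) ^ 2
        * ((1 - t ^ 2 * (q * q ^ (l i + l j + l k)) ^ 2) * (1 - (q * q ^ l k) ^ 2))
        / ((1 - (q * q ^ (l j + l k)) ^ 2) * (1 - (q * q ^ (l i + l k)) ^ 2))
        / ((1 - t ^ 2 * (q ^ (l j + l k)) ^ 2) * (1 - t ^ 2 * (q ^ (l i + l k)) ^ 2)) := by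
    have z : ∀ n : ℤ, q ^ (2 * n) = (q ^ n) ^ 2 := fun n => by
      rw [mul_comm, zpow_mul]; norm_cast
    have z' : ∀ n : ℤ, q ^ (n + 1) = q * q ^ n := fun n => by
      rw [zpow_add₀ hq, zpow_one, mul_comm]
    rw [pieriCoeff, if_pos rfl, if_pos rfl, prime_unprime, total_unprime,
      unprime_eq hij hki hkj, unprime_eq hij.symm hkj hki, total, sum_distinct hij hki hkj,
      show 2 * (l i + l j + l k) + 2 = 2 * (l i + l j + l k + 1) by ring]
    simp only [z, z', zpow_add₀ hq (l j + l k) (l i + l k)]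
  rw [p, asCoeff_add_add_eq hqt hij hki hkj, normRatio_unprime hq t hij hki hkj,
    normRatio_unprime hq t hij hki hkj]
  simp only [Pi.add_apply, Pi.single_eq_same, Pi.single_eq_of_ne hki.symm,
    Pi.single_eq_of_ne hkj.symm, add_zero, ← add_assoc]
  rw [normTotal_succ hqt (by omega), normPrime_succ q t hk, normEntry_succ hq t (by omega),
    normEntry_succ hq t (by omega)]
  have n₁ := hqt.one_sub_t_four_ne_zero (l i + l j + l k)
  have n₂ := hqt.one_sub_t_two_ne_zero (l k)
  have n₃ := hqt.one_sub_t_four_ne_zero (l j + l k)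
  have n₄ := hqt.one_sub_t_four_ne_zero (l i + l k)
  generalize 1 - t ^ 4 * (q ^ (l i + l j + l k)) ^ 2 = D₁ at *
  generalize 1 - t ^ 2 * (q ^ l k) ^ 2 = D₂ at *
  generalize 1 - t ^ 4 * (q ^ (l j + l k)) ^ 2 = D₃ at *
  generalize 1 - t ^ 4 * (q ^ (l i + l k)) ^ 2 = D₄ at *
  generalize 1 - t ^ 2 * (q ^ (l j + l k)) ^ 2 = D₅ at *
  generalize 1 - t ^ 2 * (q ^ (l i + l k)) ^ 2 = D₆ at *
  generalize 1 - (q * q ^ (l j + l k)) ^ 2 = D₇ at *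
  generalize 1 - (q * q ^ (l i + l k)) ^ 2 = D₈ at *
  generalize 1 - (q * q ^ l k) ^ 2 = D₉ at *
  generalize 1 - t ^ 2 * (q * q ^ (l i + l j + l k)) ^ 2 = E₃ at *
  generalize q ^ (l j + l k) = a at *
  generalize q ^ (l i + l k) = b at *
  -- Only factors known to be nonzero are cancelled; the others stay as inverses common to both
  -- sides.
  have h : t * D₁ * D₂ / (D₃ * D₄)
      * (t * E₃ / (q ^ 2 * D₁) * (D₉ / D₂) * (q * a ^ 2 * D₃) * (q * b ^ 2 * D₄))
        = t ^ 2 * (a * b) ^ 2 * (E₃ * D₉) := by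
    field_simp
  simp only [div_eq_mul_inv, mul_inv] at h ⊢
  linear_combination (normTotal q t (l i + l j + l k)
    * (normPrime q t (l i) * normPrime q t (l j) * normPrime q t (l k))
    * (normEntry q t (l j + l k) * normEntry q t (l i + l k) * normEntry q t (l i + l j))
    * D₇⁻¹ * D₈⁻¹ * D₅⁻¹ * D₆⁻¹) * h

/-- Parametrized by the target of the shift, so that the ratio at the source is obtained by
successor formulas from a nonnegative triple. -/
theorem asCoeff_mul_normRatio_sub_sub {q t : K} (hqt : Generic q t) {i j k : Fin 3} (hij : i ≠ j)
    (hki : k ≠ i) (hkj : k ≠ j) {l : Triple} (hl : ∀ a, 0 ≤ l a) :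
    asCoeff q t (unprime (l + Pi.single k 1)) i j k (-1) (-1) * normRatio q t (unprime l)
      = normRatio q t (unprime (l + Pi.single k 1))
        * pieriCoeff q t (unprime (l + Pi.single k 1)) i j k (-1) (-1) := by
  have hq := hqt.q_ne_zero
  have ht := hqt.t_ne_zero
  have hi := hl i
  have hj := hl j
  have hk := hl k
  have z' : ∀ n : ℤ, q ^ (n + 1) = q * q ^ n := fun n => by
    rw [zpow_add₀ hq, zpow_one, mul_comm]
  have p : pieriCoeff q t (unprime (l + Pi.single k 1)) i j k (-1) (-1)
      = (t ^ 2)⁻¹ * ((q ^ (l j + l k) * q ^ (l i + l k)) ^ 2)⁻¹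
        * ((1 - t ^ 4 * (q ^ (l i + l j + l k)) ^ 2) * (1 - t ^ 2 * (q ^ l k) ^ 2))
        * ((1 - (q * q ^ (l j + l k)) ^ 2) * (1 - (q * q ^ (l i + l k)) ^ 2))
        / ((1 - t ^ 2 * (q * q ^ (l j + l k)) ^ 2)
          * (1 - t ^ 2 * (q * q ^ (l i + l k)) ^ 2)) := by
    have z : ∀ n : ℤ, q ^ (2 * n) = (q ^ n) ^ 2 := fun n => by
      rw [mul_comm, zpow_mul]; norm_cast
    have z'' : t ^ (-2 : ℤ) = (t ^ 2)⁻¹ := by rw [zpow_neg]; norm_cast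
    rw [pieriCoeff, if_neg (by norm_num), if_neg (by norm_num), prime_unprime, total_unprime,
      unprime_eq hij hki hkj, unprime_eq hij.symm hkj hki, total, sum_distinct hij hki hkj]
    simp only [Pi.add_apply, Pi.single_eq_same, Pi.single_eq_of_ne hki.symm,
      Pi.single_eq_of_ne hkj.symm, add_zero, ← add_assoc]
    rw [show 2 * (l i + l j + l k + 1) - 2 = 2 * (l i + l j + l k) by ring,
      show 2 - (l j + l k + 1) - (l i + l k + 1) = -(l j + l k + (l i + l k)) by ring,
      add_sub_cancel_right]
    simp only [z, z', z'', zpow_neg, zpow_add₀ hq (l j + l k) (l i + l k), inv_pow]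
  rw [p, asCoeff_sub_sub_eq hqt hij hki hkj, normRatio_unprime hq t hij hki hkj,
    normRatio_unprime hq t hij hki hkj]
  simp only [Pi.add_apply, Pi.single_eq_same, Pi.single_eq_of_ne hki.symm,
    Pi.single_eq_of_ne hkj.symm, add_zero, ← add_assoc]
  rw [normTotal_succ hqt (by omega), normPrime_succ q t hk, normEntry_succ hq t (by omega),
    normEntry_succ hq t (by omega)]
  have n₁ := hqt.one_sub_t_four_ne_zero (l i + l j + l k)
  have n₂ := hqt.one_sub_t_two_ne_zero (l k)
  have n₃ := hqt.one_sub_t_two_ne_zero (l j + l k)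
  have n₄ := hqt.one_sub_t_two_ne_zero (l i + l k)
  have n₅ := hqt.one_sub_sq_ne_zero (n := l j + l k) (by omega)
  have n₆ := hqt.one_sub_sq_ne_zero (n := l i + l k) (by omega)
  have a₀ := zpow_ne_zero (l j + l k) hq
  have b₀ := zpow_ne_zero (l i + l k) hq
  generalize 1 - t ^ 4 * (q ^ (l i + l j + l k)) ^ 2 = D₁ at *
  generalize 1 - t ^ 2 * (q ^ l k) ^ 2 = D₂ at *
  generalize 1 - t ^ 4 * (q ^ (l j + l k)) ^ 2 = D₃ at *
  generalize 1 - t ^ 4 * (q ^ (l i + l k)) ^ 2 = D₄ at *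
  generalize 1 - t ^ 2 * (q ^ (l j + l k)) ^ 2 = D₅ at *
  generalize 1 - t ^ 2 * (q ^ (l i + l k)) ^ 2 = D₆ at *
  generalize 1 - (q * q ^ (l j + l k)) ^ 2 = D₇ at *
  generalize 1 - (q * q ^ (l i + l k)) ^ 2 = D₈ at *
  generalize 1 - (q * q ^ l k) ^ 2 = D₉ at *
  generalize 1 - t ^ 2 * (q * q ^ (l j + l k)) ^ 2 = E₁ at *
  generalize 1 - t ^ 2 * (q * q ^ (l i + l k)) ^ 2 = E₂ at *
  generalize 1 - t ^ 2 * (q * q ^ (l i + l j + l k)) ^ 2 = E₃ at *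
  generalize q ^ (l j + l k) = a at *
  generalize q ^ (l i + l k) = b at *
  have h : t⁻¹ * (D₉ * E₃ * D₃ * D₄) / (D₅ * D₆)
      = t * E₃ / (q ^ 2 * D₁) * (D₉ / D₂) * (q * a ^ 2 * D₃ / (D₇ * D₅))
        * (q * b ^ 2 * D₄ / (D₈ * D₆))
        * ((t ^ 2)⁻¹ * ((a * b) ^ 2)⁻¹ * (D₁ * D₂) * (D₇ * D₈)) := by
    field_simp
  simp only [div_eq_mul_inv, mul_inv] at h ⊢
  linear_combination (normTotal q t (l i + l j + l k)
    * (normPrime q t (l i) * normPrime q t (l j) * normPrime q t (l k))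
    * (normEntry q t (l j + l k) * normEntry q t (l i + l k) * normEntry q t (l i + l j))
    * E₁⁻¹ * E₂⁻¹) * h

/-- The shift leads from l + δ^i to l + δ^j. Starting from their common lower neighbour l, both
ratios are given by successor formulas. -/
theorem asCoeff_mul_normRatio_add_sub {q t : K} (hqt : Generic q t) {i j k : Fin 3} (hij : i ≠ j)
    (hki : k ≠ i) (hkj : k ≠ j) {l : Triple} (hl : ∀ a, 0 ≤ l a) :
    asCoeff q t (unprime (l + Pi.single i 1)) i j k 1 (-1)
        * normRatio q t (unprime (l + Pi.single j 1))
      = normRatio q t (unprime (l + Pi.single i 1))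
        * pieriCoeff q t (unprime (l + Pi.single i 1)) i j k 1 (-1) := by
  have hq := hqt.q_ne_zero
  have ht := hqt.t_ne_zero
  have hi := hl i
  have hj := hl j
  have hk := hl k
  have z' : ∀ n : ℤ, q ^ (n + 1) = q * q ^ n := fun n => by
    rw [zpow_add₀ hq, zpow_one, mul_comm]
  have p : pieriCoeff q t (unprime (l + Pi.single i 1)) i j k 1 (-1)
      = t * (q ^ (l j + l k) / q ^ l i) ^ 2
        * ((1 - t ^ 2 * (q ^ l i) ^ 2) * (1 - (q * q ^ l j) ^ 2))
        * (1 - (q * q ^ (l i + l k)) ^ 2) / (1 - (q * q ^ (l j + l k)) ^ 2)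
        / ((1 - t ^ 2 * (q ^ (l j + l k)) ^ 2)
          * (1 - t ^ 2 * (q * q ^ (l i + l k)) ^ 2)) := by
    have z : ∀ n : ℤ, q ^ (2 * n) = (q ^ n) ^ 2 := fun n => by
      rw [mul_comm, zpow_mul]; norm_cast
    rw [pieriCoeff, if_pos rfl, if_neg (by norm_num), prime_unprime, prime_unprime,
      unprime_eq hij hki hkj, unprime_eq hij.symm hkj hki]
    simp only [Pi.add_apply, Pi.single_eq_same, Pi.single_eq_of_ne hij.symm,
      Pi.single_eq_of_ne hki, add_zero, add_right_comm (l i) 1]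
    rw [show l j + l k - (l i + 1) + 1 = l j + l k - l i by ring, add_sub_cancel_right]
    simp only [z, z', zpow_sub₀ hq]
  rw [p, asCoeff_add_sub_eq hqt hij hki hkj, normRatio_unprime hq t hij hki hkj,
    normRatio_unprime hq t hij hki hkj]
  simp only [Pi.add_apply, Pi.single_eq_same, Pi.single_eq_of_ne hki, Pi.single_eq_of_ne hkj,
    Pi.single_eq_of_ne hij, Pi.single_eq_of_ne hij.symm, add_zero, add_right_comm _ (1 : ℤ) (l k),
    add_right_comm _ (1 : ℤ) (l j), ← add_assoc]
  rw [normPrime_succ q t hi, normPrime_succ q t hj, normEntry_succ hq t (n := l j + l k) (by omega),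
    normEntry_succ hq t (n := l i + l k) (by omega)]
  have n₁ := hqt.one_sub_t_four_ne_zero (l j + l k)
  have n₂ := hqt.one_sub_t_four_ne_zero (l i + l k)
  have n₃ := hqt.one_sub_t_two_ne_zero (l j)
  have n₇ := hqt.one_sub_t_two_ne_zero (l i)
  have n₄ := hqt.one_sub_t_two_ne_zero (l i + l k)
  have n₅ := hqt.one_sub_sq_ne_zero (n := l i + l k) (by omega)
  have n₆ := hqt.one_sub_sq_ne_zero (n := l i) (by omega)
  have a₀ := zpow_ne_zero (l j + l k) hq
  have b₀ := zpow_ne_zero (l i + l k) hq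
  have c₀ := zpow_ne_zero (l i) hq
  generalize 1 - t ^ 4 * (q ^ (l j + l k)) ^ 2 = D₁ at *
  generalize 1 - t ^ 4 * (q ^ (l i + l k)) ^ 2 = D₂ at *
  generalize 1 - t ^ 2 * (q ^ l i) ^ 2 = D₃ at *
  generalize 1 - t ^ 2 * (q ^ l j) ^ 2 = D₄ at *
  generalize 1 - t ^ 2 * (q ^ (l j + l k)) ^ 2 = D₅ at *
  generalize 1 - t ^ 2 * (q ^ (l i + l k)) ^ 2 = D₆ at *
  generalize 1 - (q * q ^ (l j + l k)) ^ 2 = D₇ at *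
  generalize 1 - (q * q ^ (l i + l k)) ^ 2 = D₈ at *
  generalize 1 - (q * q ^ l i) ^ 2 = D₉ at *
  generalize 1 - (q * q ^ l j) ^ 2 = E₁ at *
  generalize 1 - t ^ 2 * (q * q ^ (l i + l k)) ^ 2 = E₂ at *
  generalize q ^ (l j + l k) = a at *
  generalize q ^ (l i + l k) = b at *
  generalize q ^ l i = c at *
  have h : t * (b / c) ^ 2 * (D₄ * D₉ * D₂) / (D₁ * D₆) * (E₁ / D₄) * (q * a ^ 2 * D₁)
      = D₉ / D₃ * (q * b ^ 2 * D₂ / (D₈ * D₆)) * (t * (a / c) ^ 2 * (D₃ * E₁) * D₈) := by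
    field_simp
  simp only [div_eq_mul_inv, mul_inv] at h ⊢
  linear_combination (normTotal q t (l i + l j + l k + 1)
    * (normPrime q t (l i) * normPrime q t (l j) * normPrime q t (l k))
    * (normEntry q t (l j + l k) * normEntry q t (l i + l k) * normEntry q t (l i + l j + 1))
    * D₇⁻¹ * D₅⁻¹ * E₂⁻¹) * h

/-! ### Existence and uniqueness of the genus 2 Macdonald polynomials -/

theorem unprime_zero : unprime 0 = 0 := by
  funext a
  simp [unprime, total]

theorem admissible_zero : Admissible 0 := by
  simp [Admissible, total]

theorem phi_zero (q t : K) : phi q t 0 = 1 := by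
  have h1 : (kSet_finite 0).toFinset = {0} := by
    ext k
    simp only [Set.Finite.mem_toFinset, kSet, Set.mem_ofPred_eq, mem_singleton, total,
      Fin.sum_univ_three, Pi.zero_apply]
    constructor
    · rintro ⟨h, h'⟩
      have h0 := h 0
      have h1 := h 1
      have h2 := h 2
      funext a
      fin_cases a <;> simp <;> omega
    · rintro rfl
      simp
  have h2 : (polytope_finite 0 0).toFinset = {(0, 0, 0)} := by
    ext ⟨r, s, n⟩
    simp only [Set.Finite.mem_toFinset, polytope, Set.mem_ofPred_eq, mem_singleton, total,
      Fin.sum_univ_three, Pi.zero_apply, Prod.mk.injEq, unprime]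
    constructor
    · rintro ⟨hr, hs, hn, -, h⟩
      have h0 := h 0
      have h1 := h 1
      have h2 := h 2
      have r0 := hr 0
      have r1 := hr 1
      have r2 := hr 2
      have n0 := hn 0
      have n1 := hn 1
      have n2 := hn 2
      refine ⟨?_, by omega, ?_⟩ <;> funext a <;> fin_cases a <;> simp <;> omega
    · rintro ⟨rfl, rfl, rfl⟩
      simp [twicePrime, prime, total]
  have h3 : coeffC q t 0 0 0 0 0 = 1 := by
    simp [coeffC, unprime_zero, total, normSq, dot, twicePrime, prime, qPoch_zero]
  rw [phi, if_pos admissible_zero, h1, sum_singleton, h2, sum_singleton, h3,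
    AddMonoidAlgebra.one_def]
  congr 1

theorem normRatio_zero (q t : K) : normRatio q t 0 = 1 := by
  simp [normRatio, normX7, normAS, total, normSq, twicePrime, prime, qPoch_zero]

theorem shift_comm (l : Triple) (i j : Fin 3) (a b : ℤ) : shift l i j a b = shift l j i b a :=
  add_right_comm _ _ _

/-- Admissibility of the target is assumed because otherwise φ is 0 there and the coefficients need
not be compared. -/
theorem asCoeff_mul_normRatio_shift {q t : K} (hqt : Generic q t) {i j k : Fin 3} (hij : i ≠ j)
    (hki : k ≠ i) (hkj : k ≠ j) {l : Triple} (hl : Admissible l) {a b : ℤ} (ha : a ∈ signs)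
    (hb : b ∈ signs) (h : Admissible (shift l i j a b)) :
    asCoeff q t l i j k a b * normRatio q t (shift l i j a b)
      = normRatio q t l * pieriCoeff q t l i j k a b := by
  obtain ⟨l, rfl⟩ := exists_eq_unprime hl.2.1
  rw [admissible_unprime_iff] at hl
  have add_sub : ∀ {i j : Fin 3}, i ≠ j → k ≠ i → k ≠ j →
      Admissible (shift (unprime l) i j 1 (-1)) →
      asCoeff q t (unprime l) i j k 1 (-1) * normRatio q t (shift (unprime l) i j 1 (-1))
        = normRatio q t (unprime l) * pieriCoeff q t (unprime l) i j k 1 (-1) := by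
    intro i j hij hki hkj h
    rw [shift_unprime_add_sub hij hki hkj, admissible_unprime_iff] at h
    have h' : ∀ a, 0 ≤ (l - Pi.single i 1 : Triple) a := fun a => by
      by_cases ha : a = i
      · subst ha
        simpa [hij] using h a
      · simpa [ha] using hl a
    have := asCoeff_mul_normRatio_add_sub hqt hij hki hkj h'
    rwa [sub_add_cancel, ← shift_unprime_add_sub hij hki hkj] at this
  simp only [signs, mem_insert, mem_singleton] at ha hb
  rcases ha with rfl | rfl <;> rcases hb with rfl | rfl
  · rw [shift_unprime_add_add hij hki hkj]
    exact asCoeff_mul_normRatio_add_add hqt hij hki hkj hl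
  · exact add_sub hij hki hkj h
  · rw [shift_comm] at h ⊢
    rw [asCoeff_swap, pieriCoeff_swap]
    exact add_sub hij.symm hkj hki h
  · rw [shift_unprime_sub_sub hij hki hkj] at h ⊢
    have := asCoeff_mul_normRatio_sub_sub hqt hij hki hkj ((admissible_unprime_iff _).mp h)
    rwa [sub_add_cancel] at this

theorem isGenusTwoMacdonald_normRatio_smul_phi {q t : K} (hqt : Generic q t) :
    IsGenusTwoMacdonald q t fun l => normRatio q t l • phi q t l := by
  have hphi : ∀ l, ¬ Admissible l → phi q t l = 0 := fun l hl => by rw [phi, if_neg hl]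
  refine ⟨by simp only [normRatio_zero, phi_zero, one_smul],
    fun l hl => by simp only [hphi l hl, smul_zero], fun l hl i j k hij hki hkj => ?_⟩
  simp only
  rw [mul_smul_comm, xPlusInv_mul_phi hqt hl hij hki hkj, smul_sum]
  refine sum_congr rfl fun a ha => ?_
  rw [smul_sum]
  refine sum_congr rfl fun b hb => ?_
  rw [smul_smul, smul_smul]
  by_cases h : Admissible (shift l i j a b)
  · rw [asCoeff_mul_normRatio_shift hqt hij hki hkj hl ha hb h]
  · rw [hphi _ h, smul_zero, smul_zero]

theorem asCoeff_add_add_ne_zero {q t : K} (hqt : Generic q t) {i j k : Fin 3} (hij : i ≠ j)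
    (hki : k ≠ i) (hkj : k ≠ j) (l : Triple) : asCoeff q t (unprime l) i j k 1 1 ≠ 0 := by
  rw [asCoeff_add_add hqt hij hki hkj]
  exact div_ne_zero (mul_ne_zero (bracket_ne_zero hqt (by norm_num))
    (bracket_ne_zero hqt (by norm_num))) (mul_ne_zero (bracket_ne_zero hqt (by norm_num))
    (bracket_ne_zero hqt (by norm_num)))

/-- If l has a positive entry l_k, the rule at l - δ^k determines the value at l: its leading
coefficient is nonzero, and all other terms have a smaller total. -/
theorem IsGenusTwoMacdonald.unique {q t : K} (hqt : Generic q t) {Φ Ψ : Triple → Laurent K}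
    (hΦ : IsGenusTwoMacdonald q t Φ) (hΨ : IsGenusTwoMacdonald q t Ψ) : Φ = Ψ := by
  -- The strict bound makes n = 0 the case of negative total, where the triple is not admissible and
  -- both families vanish.
  have main : ∀ n : ℕ, ∀ l : Triple, total l < n → Φ (unprime l) = Ψ (unprime l) := by
    intro n
    induction n with
    | zero =>
      intro l hl
      have h : ¬ Admissible (unprime l) := by
        rw [admissible_unprime_iff]
        exact fun h => absurd (sum_nonneg fun a _ => h a) (not_le.mpr (by simpa [total] using hl))
      rw [hΦ.2.1 _ h, hΨ.2.1 _ h]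
    | succ n ih =>
      intro l hl
      by_cases h : Admissible (unprime l)
      swap
      · rw [hΦ.2.1 _ h, hΨ.2.1 _ h]
      rw [admissible_unprime_iff] at h
      by_cases h0 : l = 0
      · rw [h0, unprime_zero, hΦ.1, hΨ.1]
      obtain ⟨k, hk⟩ := Function.ne_iff.mp h0
      obtain ⟨i, j, hij, hki, hkj⟩ := exists_distinct k
      obtain ⟨l, rfl⟩ : ∃ l' : Triple, l = l' + Pi.single k 1 := ⟨l - Pi.single k 1, (sub_add_cancel _ _).symm⟩
      have hk' := h k
      have hl' : Admissible (unprime l) := by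
        rw [admissible_unprime_iff]
        intro a
        by_cases ha : a = k
        · subst ha
          simp at hk hk'
          omega
        · simpa [ha] using h a
      have e₁ := hΦ.2.2 _ hl' i j k hij hki hkj
      have e₂ := hΨ.2.2 _ hl' i j k hij hki hkj
      have tot : total l < n := by
        simp only [total, Pi.add_apply, sum_add_distrib, sum_pi_single', mem_univ, if_true] at hl
        push_cast at hl
        simp only [total]
        omega
      have tot' : ∀ a b : Fin 3, total (l - Pi.single a 1 + Pi.single b 1) = total l :=
        fun a b => by simp [total, sum_add_distrib]
      have tot'' : ∀ a : Fin 3, total (l - Pi.single a 1) = total l - 1 :=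
        fun a => by simp [total]
      simp only [sum_signs, shift_unprime_add_add hij hki hkj, shift_unprime_add_sub hij hki hkj,
        shift_unprime_sub_add hij hki hkj, shift_unprime_sub_sub hij hki hkj,
        add_sub_right_comm l] at e₁ e₂
      rw [ih l tot, e₂, ih (l - Pi.single i 1 + Pi.single j 1) (by rw [tot']; exact tot),
        ih (l - Pi.single j 1 + Pi.single i 1) (by rw [tot']; exact tot),
        ih (l - Pi.single k 1) (by rw [tot'']; omega)] at e₁
      exact (smul_right_injective _ (asCoeff_add_add_ne_zero hqt hij hki hkj l)
        (add_right_cancel (add_right_cancel (by simpa only [add_assoc] using e₁)))).symm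
  funext l
  by_cases h : Admissible l
  · obtain ⟨l, rfl⟩ := exists_eq_unprime h.2.1
    exact main ((total l).toNat + 1) l (by push_cast; omega)
  · rw [hΦ.2.1 _ h, hΨ.2.1 _ h]

end

end GenusTwo

theorem mainTheorem4 {K : Type*} [Field K] (q t : K) (hqt : GenusTwo.Generic q t) :
    (∀ l : GenusTwo.Triple, GenusTwo.Admissible l →
      ∀ i j k : Fin 3, i ≠ j → k ≠ i → k ≠ j →
        (l i ≠ 0 → l j ≠ 0 →
          GenusTwo.xPlusInv K k * GenusTwo.phi q t l
            = GenusTwo.pieriPrefactor q t l i j •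
              ∑ a ∈ GenusTwo.signs, ∑ b ∈ GenusTwo.signs,
                GenusTwo.pieriA q t l i j k a b •
                  GenusTwo.phi q t (GenusTwo.shift l i j a b)) ∧
        GenusTwo.xPlusInv K k * GenusTwo.phi q t l
          = ∑ a ∈ GenusTwo.signs, ∑ b ∈ GenusTwo.signs,
              GenusTwo.pieriCoeff q t l i j k a b •
                GenusTwo.phi q t (GenusTwo.shift l i j a b)) ∧
    ∀ Φ : GenusTwo.Triple → GenusTwo.Laurent K,
      GenusTwo.IsGenusTwoMacdonald q t Φ ↔
        ∀ l : GenusTwo.Triple,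
          Φ l = ((t * q ^ (-2 : ℤ)) ^ (GenusTwo.total l / 2)
              * (GenusTwo.normX7 q t l / GenusTwo.normAS q t l)) •
            GenusTwo.phi q t l := by
  refine ⟨fun l hl i j k hij hki hkj => ⟨fun hi hj => ?_,
    GenusTwo.xPlusInv_mul_phi hqt hl hij hki hkj⟩, fun Φ => ⟨fun h l => ?_, fun h => ?_⟩⟩
  · rw [GenusTwo.xPlusInv_mul_phi hqt hl hij hki hkj]
    simp only [Finset.smul_sum, smul_smul, GenusTwo.pieriPrefactor_mul_pieriA hqt k hi hj]
  · exact congrFun (h.unique hqt (GenusTwo.isGenusTwoMacdonald_normRatio_smul_phi hqt)) l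
  · rw [show Φ = _ from funext h]
    exact GenusTwo.isGenusTwoMacdonald_normRatio_smul_phi hqt
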